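/- Let $a,b>0$ with $2a+b<2$, and let $L$ be the operator in the complex Hilbert space $L^2(-\pi,\pi)$ given by $$(Ly)(x)=\frac{d}{dx}\Big((1-a\cos x)\,y(x)+b\sin x\cdot\frac{dy}{dx}(x)\Big),$$ with domain the set of all absolutely continuous $2\pi$-periodic functions $y$ (that is, $y$ is absolutely continuous on $[-\pi,\pi]$ and $y(-\pi)=y(\pi)$) such that $Ly\in L^2(-\pi,\pi)$, where the outer derivative is understood in the weak sense on $(-\pi,\pi)$. Then the resolvent set of $L$ is non-empty, and for every $z$ in it the resolvent $(L-z)^{-1}$ is a compact operator, in fact a Hilbert–Schmidt operator, on $L^2(-\pi,\pi)$. Consequently the spectrum of $L$ is discrete and can accumulate only at infinity: every point of the spectrum is an eigenvalue of finite algebraic multiplicity, and every bounded subset of $\mathbb{C}$ contains only finitely many points of the spectrum. -/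

import Mathlib

open MeasureTheory Set Filter Topology

noncomputable section

/-! ### Unbounded operators: resolvent, spectrum, generalized eigenspaces -/

section UnboundedOperators

variable {E : Type*} [NormedAddCommGroup E] [NormedSpace ℂ E]

/-- `R` is the resolvent of the (in general unbounded) operator `T` at the point `z`: a bounded,
everywhere defined, two-sided inverse of `T - z : dom T → E`. -/
structure IsResolventAt (T : E →ₗ.[ℂ] E) (z : ℂ) (R : E →L[ℂ] E) : Prop where
  /-- `R` maps into the domain of `T`. -/
  mem_domain : ∀ f : E, R f ∈ T.domain
  /-- `(T - z) R = 1`. -/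
  right_inv : ∀ f : E, T ⟨R f, mem_domain f⟩ - z • R f = f
  /-- `R (T - z) = 1` on the domain of `T`. -/
  left_inv : ∀ y : T.domain, R (T y - z • (y : E)) = y

/-- The resolvent set of an unbounded operator. -/
def unboundedResolventSet (T : E →ₗ.[ℂ] E) : Set ℂ :=
  {z | ∃ R : E →L[ℂ] E, IsResolventAt T z R}

/-- The spectrum of an unbounded operator. -/
def unboundedSpectrum (T : E →ₗ.[ℂ] E) : Set ℂ :=
  (unboundedResolventSet T)ᶜ

/-- `z` is an eigenvalue of `T`. -/
def IsUnboundedEigenvalue (T : E →ₗ.[ℂ] E) (z : ℂ) : Prop :=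
  ∃ y : T.domain, y ≠ 0 ∧ T y = z • (y : E)

/-- The kernel of `(T - z) ^ n`, the power being taken on its natural domain: `y` belongs to
`ker (T - z) ^ (n + 1)` iff `y ∈ dom T` and `(T - z) y ∈ ker (T - z) ^ n`. -/
def kerPow (T : E →ₗ.[ℂ] E) (z : ℂ) : ℕ → Submodule ℂ E
  | 0 => ⊥
  | n + 1 => ((kerPow T z n).comap (T.toFun - z • T.domain.subtype)).map T.domain.subtype

/-- The generalized eigenspace (root space) of `T` at `z`; its dimension is the algebraic
multiplicity of `z`. -/
def rootSpace (T : E →ₗ.[ℂ] E) (z : ℂ) : Submodule ℂ E :=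
  ⨆ n : ℕ, kerPow T z n

end UnboundedOperators

/-! ### Hilbert–Schmidt operators -/

/-- A bounded operator `R` on a Hilbert space is Hilbert–Schmidt if `∑ ‖R eᵢ‖² < ∞` for an
orthonormal (Hilbert) basis `(eᵢ)`; the sum does not depend on the basis. -/
def IsHilbertSchmidt {E : Type} [NormedAddCommGroup E] [InnerProductSpace ℂ E]
    (R : E →L[ℂ] E) : Prop :=
  ∃ (ι : Type) (e : HilbertBasis ι ℂ E), Summable fun i => ‖R (e i)‖ ^ 2

/-! ### The operator `L` -/

/-- The measure space `(-π, π)` with Lebesgue measure. -/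
abbrev intervalMeasure : Measure ℝ := volume.restrict (Ioo (-Real.pi) Real.pi)

/-- The complex Hilbert space `L²(-π, π)`. -/
abbrev L2Interval : Type := Lp ℂ 2 intervalMeasure

/-- The first order expression `(1 - a cos x) y(x) + b sin x · y'(x)`. -/
def firstOrder (a b : ℝ) (y : ℝ → ℂ) (x : ℝ) : ℂ :=
  ((1 - a * Real.cos x : ℝ) : ℂ) * y x + ((b * Real.sin x : ℝ) : ℂ) * deriv y x

/-- `y` is absolutely continuous on `[-π, π]` with `y(-π) = y(π)`, and
`f = d/dx ((1 - a cos x) y + b sin x · y')` on `(-π, π)`. The outer derivative is the one of an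
absolutely continuous function `u` on `[-π, π]` that is almost everywhere equal to the
expression to be differentiated, i.e. it is the weak derivative. -/
structure IsActionOfL (a b : ℝ) (y u f : ℝ → ℂ) : Prop where
  ac : AbsolutelyContinuousOnInterval y (-Real.pi) Real.pi
  periodic : y (-Real.pi) = y Real.pi
  ac_first : AbsolutelyContinuousOnInterval u (-Real.pi) Real.pi
  first_eq : u =ᵐ[intervalMeasure] firstOrder a b y
  deriv_eq : f =ᵐ[intervalMeasure] deriv u

theorem ae_differentiableAt_of_ac {y : ℝ → ℂ}
    (h : AbsolutelyContinuousOnInterval y (-Real.pi) Real.pi) :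
    ∀ᵐ x ∂intervalMeasure, DifferentiableAt ℝ y x := by
  have h1 := h.boundedVariationOn.ae_differentiableAt_of_mem_uIcc
  rw [ae_restrict_iff' measurableSet_Ioo]
  filter_upwards [h1] with x hx hxI
  apply hx
  rw [uIcc_of_le (by linarith [Real.pi_pos])]
  exact Ioo_subset_Icc_self hxI

theorem eqOn_zero_of_ac {y : ℝ → ℂ}
    (h : AbsolutelyContinuousOnInterval y (-Real.pi) Real.pi)
    (h0 : y =ᵐ[intervalMeasure] 0) : EqOn y 0 (Ioo (-Real.pi) Real.pi) := by
  refine Measure.eqOn_open_of_ae_eq h0 isOpen_Ioo ?_ continuousOn_const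
  refine h.continuousOn.mono ?_
  rw [uIcc_of_le (by linarith [Real.pi_pos])]
  exact Ioo_subset_Icc_self

theorem deriv_ae_zero_of_ac {y : ℝ → ℂ}
    (h : AbsolutelyContinuousOnInterval y (-Real.pi) Real.pi)
    (h0 : y =ᵐ[intervalMeasure] 0) : deriv y =ᵐ[intervalMeasure] 0 := by
  refine (ae_restrict_iff' measurableSet_Ioo).2 (Eventually.of_forall fun x hx => ?_)
  have : y =ᶠ[𝓝 x] fun _ => (0 : ℂ) := by
    filter_upwards [isOpen_Ioo.mem_nhds hx] with t ht
    exact eqOn_zero_of_ac h h0 ht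
  rw [this.deriv_eq]
  simp

theorem IsActionOfL.add {a b : ℝ} {y₁ y₂ u₁ u₂ f₁ f₂ : ℝ → ℂ}
    (h₁ : IsActionOfL a b y₁ u₁ f₁) (h₂ : IsActionOfL a b y₂ u₂ f₂) :
    IsActionOfL a b (y₁ + y₂) (u₁ + u₂) (f₁ + f₂) where
  ac := h₁.ac.add h₂.ac
  periodic := by simp [h₁.periodic, h₂.periodic]
  ac_first := h₁.ac_first.add h₂.ac_first
  first_eq := by
    filter_upwards [h₁.first_eq, h₂.first_eq, ae_differentiableAt_of_ac h₁.ac,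
      ae_differentiableAt_of_ac h₂.ac] with x e₁ e₂ d₁ d₂
    simp only [Pi.add_apply, e₁, e₂, firstOrder, deriv_add d₁ d₂]
    ring
  deriv_eq := by
    filter_upwards [h₁.deriv_eq, h₂.deriv_eq, ae_differentiableAt_of_ac h₁.ac_first,
      ae_differentiableAt_of_ac h₂.ac_first] with x e₁ e₂ d₁ d₂
    simp only [Pi.add_apply, e₁, e₂, deriv_add d₁ d₂]

theorem IsActionOfL.smul {a b : ℝ} {y u f : ℝ → ℂ} (c : ℂ) (h : IsActionOfL a b y u f) :
    IsActionOfL a b (c • y) (c • u) (c • f) where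
  ac := h.ac.const_smul c
  periodic := by simp [h.periodic]
  ac_first := h.ac_first.const_smul c
  first_eq := by
    filter_upwards [h.first_eq, ae_differentiableAt_of_ac h.ac] with x e d
    simp only [Pi.smul_apply, e, firstOrder, deriv_const_smul c d, smul_eq_mul]
    ring
  deriv_eq := by
    filter_upwards [h.deriv_eq, ae_differentiableAt_of_ac h.ac_first] with x e d
    simp only [Pi.smul_apply, e, deriv_const_smul c d]

theorem IsActionOfL.congr {a b : ℝ} {y u f g : ℝ → ℂ} (h : IsActionOfL a b y u f)
    (hg : g =ᵐ[intervalMeasure] f) : IsActionOfL a b y u g :=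
  { h with deriv_eq := hg.trans h.deriv_eq }

theorem isActionOfL_zero (a b : ℝ) : IsActionOfL a b 0 0 0 where
  ac := (LipschitzWith.const (0 : ℂ)).lipschitzOnWith.absolutelyContinuousOnInterval
  periodic := rfl
  ac_first := (LipschitzWith.const (0 : ℂ)).lipschitzOnWith.absolutelyContinuousOnInterval
  first_eq := Eventually.of_forall fun x => by simp [firstOrder]
  deriv_eq := Eventually.of_forall fun x => by simp

/-- The graph of `L`: pairs `(Y, F)` of elements of `L²(-π, π)` such that `Y` has an absolutely
continuous periodic representative `y` with `d/dx ((1 - a cos x) y + b sin x · y') = F`. -/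
def graphL (a b : ℝ) : Submodule ℂ (L2Interval × L2Interval) where
  carrier := {p | ∃ y u : ℝ → ℂ, p.1 =ᵐ[intervalMeasure] y ∧ IsActionOfL a b y u p.2}
  zero_mem' := ⟨0, 0, Lp.coeFn_zero _ _ _, (isActionOfL_zero a b).congr (Lp.coeFn_zero _ _ _)⟩
  add_mem' := by
    rintro p q ⟨y₁, u₁, e₁, h₁⟩ ⟨y₂, u₂, e₂, h₂⟩
    exact ⟨y₁ + y₂, u₁ + u₂, (Lp.coeFn_add _ _).trans (e₁.add e₂),
      (h₁.add h₂).congr (Lp.coeFn_add _ _)⟩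
  smul_mem' := by
    rintro c p ⟨y, u, e, h⟩
    exact ⟨c • y, c • u, (Lp.coeFn_smul _ _).trans (e.const_smul c),
      (h.smul c).congr (Lp.coeFn_smul _ _)⟩

theorem graphL_functional (a b : ℝ) :
    ∀ p ∈ graphL a b, p.1 = 0 → p.2 = 0 := by
  rintro ⟨p, f⟩ ⟨y, u, e, h⟩ hp
  simp only at e h hp ⊢
  subst hp
  have hy : y =ᵐ[intervalMeasure] 0 := e.symm.trans (Lp.coeFn_zero _ _ _)
  have hu : u =ᵐ[intervalMeasure] 0 := by
    filter_upwards [h.first_eq, hy, deriv_ae_zero_of_ac h.ac hy] with x e₁ e₂ e₃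
    simp [e₁, firstOrder, e₂, e₃]
  exact (Lp.eq_zero_iff_ae_eq_zero).2 (h.deriv_eq.trans (deriv_ae_zero_of_ac h.ac_first hu))

/-- The operator `(L y)(x) = d/dx ((1 - a cos x) y(x) + b sin x · y'(x))` in `L²(-π, π)`, with
domain all absolutely continuous `2π`-periodic `y` such that `L y ∈ L²(-π, π)`. -/
def operatorL (a b : ℝ) : L2Interval →ₗ.[ℂ] L2Interval :=
  (graphL a b).toLinearPMap

/-- The graph of `operatorL a b` is indeed `graphL a b`. -/
theorem operatorL_graph (a b : ℝ) : (operatorL a b).graph = graphL a b :=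
  Submodule.toLinearPMap_graph_eq _ fun p hp h0 => graphL_functional a b p hp h0

end

/-! ### Hilbert–Schmidt operators are compact -/

section HilbertSchmidt

variable {E : Type*} [NormedAddCommGroup E] [InnerProductSpace ℂ E]

/-! Write m = 1 - a cos x. The hypotheses give a < 1, so 1 - a ≤ m ≤ 1 + a with both bounds
positive. The equation Ly = g splits into u' = g and m y + b sin x · y' = u, the second singular at
0 and ±π. On (0, π) an integrating factor p satisfies p'/p = m/(b sin x), with p → 0 at 0 and p → ∞
at π. Hence (p y)' = w u with w = p/(b sin x). The constant of integration vanishes because p(0) =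
0, so y = p⁻¹ ∫₀ˣ w u; reflection handles (-π, 0). Since m w = p', this solution operator is bounded
by sup|u|/(1 - a).

For absolutely continuous u the solution is absolutely continuous on all of [-π, π], with (1 + a)
y(±π) = u(±π) (`exists_absolutelyContinuous_firstOrder_eq`, `boundary_values_of_firstOrder_eq`).
Periodicity of y is therefore u(-π) = u(π), that is ∫ g = 0. With K the solution operator after
integration and φ the solution for u = 1, the graph of L consists of the pairs (Kg + cφ, g) with ∫ g
= 0 (`mem_graphL_iff`). K is Hilbert–Schmidt because its point evaluations are uniformly bounded
functionals on L², so Bessel's inequality can be integrated over x.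

Solving (L - z)y = f means y = S(Kf + cφ) with S = (1 - zK)⁻¹, where c is fixed by ∫ (f + zy) = 0.
This determines c when z ≠ 0 and ∫ Sφ ≠ 0, which holds for small nonzero z because Re φ ≥ 1/(1 + a)
a.e. makes ∫ φ ≠ 0. The resolvent is SK plus a rank one operator, hence Hilbert–Schmidt. The
spectral statements then follow from Riesz theory for the compact resolvent. -/

theorem HilbertBasis.summable_sq_norm_comp_left {ι : Type*} (e : HilbertBasis ι ℂ E)
    {R : E →L[ℂ] E} (h : Summable fun i => ‖R (e i)‖ ^ 2) (B : E →L[ℂ] E) :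
    Summable fun i => ‖(B * R) (e i)‖ ^ 2 := by
  refine Summable.of_nonneg_of_le (fun i => by positivity) (fun i => ?_) (h.mul_left (‖B‖ ^ 2))
  rw [← mul_pow]
  gcongr
  exact B.le_opNorm _

theorem HilbertBasis.summable_sq_norm_add {ι : Type*} (e : HilbertBasis ι ℂ E)
    {R S : E →L[ℂ] E} (hR : Summable fun i => ‖R (e i)‖ ^ 2)
    (hS : Summable fun i => ‖S (e i)‖ ^ 2) : Summable fun i => ‖(R + S) (e i)‖ ^ 2 := by
  refine Summable.of_nonneg_of_le (fun i => by positivity) (fun i => ?_)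
    ((hR.add hS).mul_left 2)
  have h1 : ‖(R + S) (e i)‖ ≤ ‖R (e i)‖ + ‖S (e i)‖ := norm_add_le _ _
  nlinarith [norm_nonneg ((R + S) (e i)), sq_nonneg (‖R (e i)‖ - ‖S (e i)‖)]

/-- Bessel's inequality for a bounded functional. -/
theorem Orthonormal.sum_sq_norm_apply_le [CompleteSpace E] {ι : Type*} {e : ι → E}
    (he : Orthonormal ℂ e) (l : E →L[ℂ] ℂ) (s : Finset ι) :
    ∑ i ∈ s, ‖l (e i)‖ ^ 2 ≤ ‖l‖ ^ 2 := by
  have h := he.sum_inner_products_le (s := s) ((InnerProductSpace.toDual ℂ E).symm l)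
  rw [LinearIsometryEquiv.norm_map] at h
  refine le_trans (le_of_eq (Finset.sum_congr rfl fun i _ => ?_)) h
  rw [norm_inner_symm, InnerProductSpace.toDual_symm_apply]

theorem HilbertBasis.summable_sq_norm_smulRight [CompleteSpace E] {ι : Type*}
    (e : HilbertBasis ι ℂ E) (l : E →L[ℂ] ℂ) (v : E) :
    Summable fun i => ‖(l.smulRight v) (e i)‖ ^ 2 := by
  have h : Summable fun i => ‖l (e i)‖ ^ 2 :=
    summable_of_sum_le (fun i => by positivity) (e.orthonormal.sum_sq_norm_apply_le l)
  refine (h.mul_right (‖v‖ ^ 2)).congr fun i => ?_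
  simp [norm_smul, mul_pow]

/-- The finite rank truncations along the basis converge in operator norm: Cauchy–Schwarz and Bessel
bound a tail applied to x by ‖x‖ times the square root of the tail of ∑ ‖R eᵢ‖². -/
theorem isCompactOperator_of_summable_sq_norm [CompleteSpace E] {ι : Type*}
    (e : HilbertBasis ι ℂ E) {R : E →L[ℂ] E} (h : Summable fun i => ‖R (e i)‖ ^ 2) :
    IsCompactOperator R := by
  classical
  let F : Finset ι → E →L[ℂ] E := fun s => ∑ i ∈ s, (innerSL ℂ (e i)).smulRight (R (e i))
  have hF : ∀ s x, F s x = ∑ i ∈ s, inner ℂ (e i) x • R (e i) := fun s x => by simp [F]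
  have hlim : ∀ x, Tendsto (fun s => F s x) atTop (𝓝 (R x)) := fun x => by
    have h1 : HasSum (fun i => R (e.repr x i • e i)) (R x) := (e.hasSum_repr x).mapL R
    refine Tendsto.congr (fun s => ?_) h1
    rw [hF]
    exact Finset.sum_congr rfl fun i _ =>
      (map_smul R _ _).trans (congrArg (· • R (e i)) (e.repr_apply_apply x i))
  have hcomp : ∀ s, IsCompactOperator (F s) := fun s => by
    have : ∀ i, IsCompactOperator ((innerSL ℂ (e i)).smulRight (R (e i))) := fun i =>
      (isCompactOperator_id.comp_clm (innerSL ℂ (e i))).clm_comp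
        ((ContinuousLinearMap.id ℂ ℂ).smulRight (R (e i)))
    exact Submodule.sum_mem (compactOperator (RingHom.id ℂ) E E) fun i _ => this i
  refine isCompactOperator_of_tendsto (l := atTop) (F := F) ?_ (Eventually.of_forall hcomp)
  rw [Metric.tendsto_atTop]
  intro ε hε
  obtain ⟨s, hs⟩ := summable_iff_vanishing_norm.1 h ((ε / 2) ^ 2) (by positivity)
  refine ⟨s, fun t hst => ?_⟩
  rw [dist_comm, dist_eq_norm]
  refine lt_of_le_of_lt (ContinuousLinearMap.opNorm_le_bound _ (half_pos hε).le fun x => ?_)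
    (half_lt_self hε)
  have h2 : Tendsto (fun r => ‖F r x - F t x‖) atTop (𝓝 ‖R x - F t x‖) :=
    ((hlim x).sub_const _).norm
  refine le_of_tendsto h2 ?_
  filter_upwards [eventually_ge_atTop t] with r hr
  have h3 : F r x - F t x = ∑ i ∈ r \ t, inner ℂ (e i) x • R (e i) := by
    rw [hF, hF, ← Finset.sum_sdiff hr, add_sub_cancel_right]
  have h4 : ∑ i ∈ r \ t, ‖R (e i)‖ ^ 2 ≤ (ε / 2) ^ 2 := by
    refine le_trans (le_abs_self _) (hs (r \ t) ?_).le
    exact Finset.disjoint_left.2 fun i hi his => (Finset.mem_sdiff.1 hi).2 (hst his)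
  have h5 : ∑ i ∈ r \ t, ‖inner ℂ (e i) x‖ ^ 2 ≤ ‖x‖ ^ 2 := e.orthonormal.sum_inner_products_le x
  rw [h3]
  calc ‖∑ i ∈ r \ t, inner ℂ (e i) x • R (e i)‖
      ≤ ∑ i ∈ r \ t, ‖inner ℂ (e i) x‖ * ‖R (e i)‖ :=
        (norm_sum_le _ _).trans (le_of_eq (Finset.sum_congr rfl fun i _ => norm_smul _ _))
    _ ≤ √(∑ i ∈ r \ t, ‖inner ℂ (e i) x‖ ^ 2) * √(∑ i ∈ r \ t, ‖R (e i)‖ ^ 2) :=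
        Real.sum_mul_le_sqrt_mul_sqrt _ _ _
    _ ≤ ‖x‖ * (ε / 2) :=
        mul_le_mul ((Real.sqrt_le_left (norm_nonneg x)).2 h5)
          ((Real.sqrt_le_left (half_pos hε).le).2 h4) (Real.sqrt_nonneg _) (norm_nonneg _)
    _ = ε / 2 * ‖x‖ := mul_comm _ _

end HilbertSchmidt

/-! ### Compact operators: chains of invariant subspaces -/

section CompactChains

variable {E : Type*} [NormedAddCommGroup E] [NormedSpace ℂ E]

/-- A compact operator admits no infinite strictly increasing chain of closed subspaces along which
it acts triangularly with diagonal entries bounded away from zero. -/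
theorem IsCompactOperator.not_exists_triangular_chain {R : E →L[ℂ] E} (hR : IsCompactOperator R)
    {V : ℕ → Submodule ℂ E} (hclosed : ∀ n, IsClosed (V n : Set E)) (hlt : ∀ n, V n < V (n + 1))
    {μ : ℕ → ℂ} {ε : ℝ} (hε : 0 < ε) (hμ : ∀ n, ε ≤ ‖μ n‖)
    (htri : ∀ n, ∀ x ∈ V (n + 1), R x - μ n • x ∈ V n) : False := by
  have hmono : Monotone V := monotone_nat_of_le_succ fun n => (hlt n).le
  have hinv : ∀ n, ∀ x ∈ V (n + 1), R x ∈ V (n + 1) := fun n x hx => by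
    have := (V (n + 1)).add_mem ((hlt n).le (htri n x hx)) ((V (n + 1)).smul_mem (μ n) hx)
    simpa using this
  -- Riesz's lemma inside `V (n + 1)` gives unit vectors at distance at least 1/2 from `V n`; their
  -- images will have no Cauchy subsequence.
  have key : ∀ n, ∃ x ∈ V (n + 1), ‖x‖ = 1 ∧ ∀ y ∈ V n, (1 / 2 : ℝ) ≤ ‖x - y‖ := fun n => by
    obtain ⟨z, hz, hzn⟩ := SetLike.exists_of_lt (hlt n)
    obtain ⟨x, -, hx1, hx2⟩ := riesz_lemma_of_lt_one (𝕜 := ℂ)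
      (F := (V n).comap (V (n + 1)).subtype) ((hclosed n).preimage continuous_subtype_val)
      ⟨⟨z, hz⟩, hzn⟩ (r := 1 / 2) (by norm_num)
    exact ⟨x, x.2, hx1, fun y hy => hx2 ⟨y, (hlt n).le hy⟩ hy⟩
  choose x hxV hx1 hx2 using key
  have hsep : ∀ m n, m < n → ε / 2 ≤ ‖R (x n) - R (x m)‖ := fun m n hmn => by
    have hμn : μ n ≠ 0 := norm_pos_iff.1 (hε.trans_le (hμ n))
    -- By triangularity R xₙ - R xₘ is μₙ times (xₙ minus an element of `V n`), so its norm is at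
    -- least |μₙ|/2.
    have hy : (μ n)⁻¹ • (R (x m) - (R (x n) - μ n • x n)) ∈ V n := by
      refine (V n).smul_mem _ ((V n).sub_mem ?_ (htri n _ (hxV n)))
      exact hmono hmn (hinv m _ (hxV m))
    have h := hx2 n _ hy
    have he : R (x n) - R (x m) = μ n • (x n - (μ n)⁻¹ • (R (x m) - (R (x n) - μ n • x n))) := by
      rw [smul_sub, smul_inv_smul₀ hμn]; abel
    rw [he, norm_smul]
    nlinarith [hμ n]
  obtain ⟨K, hK, hK'⟩ := hR.image_closedBall_subset_compact 1
  obtain ⟨y, -, ψ, hψ, hψy⟩ := hK.tendsto_subseq (x := fun n => R (x n))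
    (fun n => hK' ⟨x n, by simp [hx1 n], rfl⟩)
  obtain ⟨N, hN⟩ := Metric.cauchySeq_iff'.1 hψy.cauchySeq (ε / 2) (by positivity)
  have h1 := hN (N + 1) (by omega)
  rw [dist_eq_norm] at h1
  exact absurd (hsep _ _ (hψ (Nat.lt_succ_self N))) (not_le.2 h1)

/-- A compact operator has only finitely many eigenvalues outside any disc around zero. -/
theorem IsCompactOperator.finite_setOf_hasEigenvalue {R : E →L[ℂ] E} (hR : IsCompactOperator R)
    {ε : ℝ} (hε : 0 < ε) :
    {μ : ℂ | ε ≤ ‖μ‖ ∧ Module.End.HasEigenvalue (R : Module.End ℂ E) μ}.Finite := by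
  by_contra hinf
  obtain ⟨μ, hμ⟩ : Nonempty (ℕ ↪ {μ : ℂ | ε ≤ ‖μ‖ ∧
      Module.End.HasEigenvalue (R : Module.End ℂ E) μ}) :=
    ⟨Set.Infinite.natEmbedding _ hinf⟩
  have hev : ∀ n, ∃ v, Module.End.HasEigenvector (R : Module.End ℂ E) (μ n : ℂ) v := fun n =>
    (μ n).2.2.exists_hasEigenvector
  choose v hv using hev
  have hli : LinearIndependent ℂ v := Module.End.eigenvectors_linearIndependent' _
    (fun n => (μ n : ℂ)) (Subtype.coe_injective.comp hμ) v hv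
  have hRv : ∀ n, R (v n) = (μ n : ℂ) • v n := fun n => (hv n).apply_eq_smul
  let V : ℕ → Submodule ℂ E := fun n => Submodule.span ℂ (v '' Iio n)
  have hfin : ∀ n, FiniteDimensional ℂ (V n) := fun n =>
    FiniteDimensional.span_of_finite ℂ ((Set.finite_Iio n).image v)
  have hle : ∀ n, V n ≤ V (n + 1) := fun n =>
    Submodule.span_mono (image_mono (Iio_subset_Iio (Nat.le_succ n)))
  have hmem : ∀ n, v n ∈ V (n + 1) := fun n =>
    Submodule.subset_span ⟨n, Nat.lt_succ_self n, rfl⟩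
  have hinv : ∀ n, ∀ x ∈ V n, R x ∈ V n := fun n x hx => by
    induction hx using Submodule.span_induction with
    | mem x hx =>
      obtain ⟨k, hk, rfl⟩ := hx
      rw [hRv]
      exact (V n).smul_mem _ (Submodule.subset_span ⟨k, hk, rfl⟩)
    | zero => simp
    | add x y _ _ hx hy => rw [map_add]; exact (V n).add_mem hx hy
    | smul c x _ hx => rw [map_smul]; exact (V n).smul_mem _ hx
  -- The spans of the first n eigenvectors form the chain; R - μₙ kills the newest eigenvector and
  -- preserves the earlier span.
  refine hR.not_exists_triangular_chain (V := V) (μ := fun n => (μ n : ℂ))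
    (fun n => (V n).closed_of_finiteDimensional) (fun n => lt_of_le_of_ne (hle n) ?_) hε
    (fun n => (μ n).2.1) (fun n x hx => ?_)
  · intro h
    exact hli.notMem_span_image (s := Iio n) (x := n) (by simp) (h ▸ hmem n : v n ∈ V n)
  · induction hx using Submodule.span_induction with
    | mem x hx =>
      obtain ⟨k, hk, rfl⟩ := hx
      rcases (Nat.lt_succ_iff_lt_or_eq.1 hk) with h | rfl
      · have hk' : v k ∈ V n := Submodule.subset_span ⟨k, h, rfl⟩
        exact (V n).sub_mem (hinv n _ hk') ((V n).smul_mem _ hk')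
      · simp [hRv]
    | zero => simp
    | add x y _ _ hx hy =>
      have := (V n).add_mem hx hy
      rwa [show R x - (μ n : ℂ) • x + (R y - (μ n : ℂ) • y)
        = R (x + y) - (μ n : ℂ) • (x + y) by rw [map_add, smul_add]; abel] at this
    | smul c x _ hx =>
      have := (V n).smul_mem c hx
      rwa [show c • (R x - (μ n : ℂ) • x) = R (c • x) - (μ n : ℂ) • (c • x) by
        rw [map_smul, smul_sub, smul_comm c]] at this

/-- The root spaces of a compact operator at nonzero points are finite dimensional. -/
theorem IsCompactOperator.finiteDimensional_maxGenEigenspace {R : E →L[ℂ] E}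
    (hR : IsCompactOperator R) {μ : ℂ} (hμ : μ ≠ 0) :
    FiniteDimensional ℂ (Module.End.maxGenEigenspace (R : E →ₗ[ℂ] E) μ) := by
  let S : E →L[ℂ] E := R - μ • 1
  have hS : ∀ x, S x = R x - μ • x := fun x => by simp [S]
  let V : ℕ → Submodule ℂ E := fun n => ((S ^ n : E →L[ℂ] E) : E →ₗ[ℂ] E).ker
  have hVmem : ∀ n x, x ∈ V n ↔ (S ^ n) x = 0 := fun n x => Iff.rfl
  have hsucc : ∀ n x, x ∈ V (n + 1) ↔ S x ∈ V n := fun n x => by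
    rw [hVmem, hVmem, pow_succ]; rfl
  have hclosed : ∀ n, IsClosed (V n : Set E) := fun n => (S ^ n : E →L[ℂ] E).isClosed_ker
  have hle : ∀ n, V n ≤ V (n + 1) := fun n x hx => by
    rw [hVmem] at hx ⊢
    rw [pow_succ', mul_apply_eq_comp, hx, map_zero]
  have hpow : ∀ n x, (((R : Module.End ℂ E) - μ • (1 : Module.End ℂ E)) ^ n) x = (S ^ n) x :=
    fun n x => by
      rw [show (R : Module.End ℂ E) - μ • (1 : Module.End ℂ E) = (S : E →ₗ[ℂ] E) from rfl,
        ← ContinuousLinearMap.toLinearMap_pow]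
      rfl
  -- On the eigenspace μ⁻¹R is the identity, so the identity there is compact.
  have hV1 : FiniteDimensional ℂ (V 1) := by
    have hx : ∀ x : V 1, R x = μ • (x : E) := fun x => by
      have := (hVmem 1 x).1 x.2
      rwa [pow_one, hS, sub_eq_zero] at this
    have hinv : ∀ x : V 1, R x ∈ V 1 := fun x => by
      rw [hx]; exact (V 1).smul_mem _ x.2
    have hc : IsCompactOperator (Set.codRestrict (R ∘ (V 1).subtypeL) (V 1) hinv) :=
      (hR.comp_clm (V 1).subtypeL).codRestrict hinv (hclosed 1)
    have hid := hc.smul (μ⁻¹)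
    have : (μ⁻¹ • Set.codRestrict (R ∘ (V 1).subtypeL) (V 1) hinv) = id := by
      funext x
      apply Subtype.ext
      simp [hx, hμ]
    rw [this] at hid
    exact FiniteDimensional.of_isCompactOperator_id hid
  have hfin : ∀ n, FiniteDimensional ℂ (V n) := fun n => by
    induction n with
    | zero =>
      have : V 0 = ⊥ := by
        rw [eq_bot_iff]; intro x hx
        simpa [hVmem] using hx
      rw [this]; infer_instance
    | succ n ih =>
      have h1 : V (n + 1) = (V n).comap (S : E →ₗ[ℂ] E) := by ext x; exact hsucc n x
      have h2 : FiniteDimensional ℂ (S : E →ₗ[ℂ] E).ker := by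
        have : (S : E →ₗ[ℂ] E).ker = V 1 := by ext x; simp [hVmem]
        rw [this]; exact hV1
      rw [h1]
      infer_instance
  -- Kernels of powers of S = R - μ that never stabilised would be a forbidden chain with constant
  -- diagonal μ, since S maps each kernel into the previous one.
  have hstab : ∃ n, V n = V (n + 1) := by
    by_contra! h
    refine hR.not_exists_triangular_chain hclosed (fun n => lt_of_le_of_ne (hle n) (h n))
      (norm_pos_iff.2 hμ) (μ := fun _ => μ) (fun _ => le_rfl) fun n x hx => ?_
    rw [← hS]; exact (hsucc n x).1 hx
  obtain ⟨n, hn⟩ := hstab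
  have hconst : ∀ k, V (n + k) = V n := fun k => by
    induction k with
    | zero => rfl
    | succ k ih =>
      ext x
      rw [← add_assoc, hsucc, ih, ← hsucc, ← hn]
  have : Module.End.maxGenEigenspace (R : E →ₗ[ℂ] E) μ = V n := by
    ext x
    rw [Module.End.mem_maxGenEigenspace]
    refine ⟨fun ⟨k, hk⟩ => ?_, fun hx => ⟨n, (hpow n x).trans hx⟩⟩
    have hxk : x ∈ V k := (hpow k x).symm.trans hk
    rw [← hconst k, add_comm]
    exact (monotone_nat_of_le_succ hle) (Nat.le_add_right k n) hxk
  rw [this]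
  exact hfin n

end CompactChains

/-! ### Unbounded operators with a compact resolvent -/

section CompactResolvent

variable {E : Type*} [NormedAddCommGroup E] [NormedSpace ℂ E]

theorem IsResolventAt.apply_eq {T : E →ₗ.[ℂ] E} {z : ℂ} {R : E →L[ℂ] E} (h : IsResolventAt T z R)
    (f : E) : T ⟨R f, h.mem_domain f⟩ = f + z • R f :=
  sub_eq_iff_eq_add.1 (h.right_inv f)

/-- The first resolvent identity. -/
theorem IsResolventAt.eq_add_smul_mul {T : E →ₗ.[ℂ] E} {z₀ z : ℂ} {R₀ R : E →L[ℂ] E}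
    (h₀ : IsResolventAt T z₀ R₀) (h : IsResolventAt T z R) :
    R = R₀ + ((z - z₀) • R) * R₀ := by
  ext f
  have h1 := h.left_inv ⟨R₀ f, h₀.mem_domain f⟩
  rw [h₀.apply_eq] at h1
  have h2 : f + z₀ • R₀ f - z • R₀ f = f - (z - z₀) • R₀ f := by
    rw [sub_smul]; abel
  simp only [h2, map_sub, map_smul] at h1
  change R f = R₀ f + (z - z₀) • R (R₀ f)
  exact sub_eq_iff_eq_add.1 h1

/-- On the domain, T - z = (1 - (z - z₀)R₀)(T - z₀), so inverting the bounded factor inverts T - z.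
-/
theorem IsResolventAt.of_isUnit {T : E →ₗ.[ℂ] E} {z₀ z : ℂ} {R₀ : E →L[ℂ] E}
    (h₀ : IsResolventAt T z₀ R₀) {B : E →L[ℂ] E} (h1 : (1 - (z - z₀) • R₀) * B = 1)
    (h2 : B * (1 - (z - z₀) • R₀) = 1) : IsResolventAt T z (R₀ * B) := by
  have h1' : ∀ f, B f - (z - z₀) • R₀ (B f) = f := fun f => congrArg (fun S => S f) h1
  have h2' : ∀ f, B (f - (z - z₀) • R₀ f) = f := fun f => congrArg (fun S => S f) h2
  refine ⟨fun f => h₀.mem_domain _, fun f => ?_, fun y => ?_⟩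
  · refine Eq.trans ?_ (h1' f)
    change T ⟨R₀ (B f), h₀.mem_domain _⟩ - z • R₀ (B f) = _
    rw [h₀.apply_eq, sub_smul]; abel
  · change R₀ (B (T y - z • (y : E))) = y
    have h3 := h₀.left_inv y
    have h4 : T y - z • (y : E) = (T y - z₀ • (y : E)) - (z - z₀) • R₀ (T y - z₀ • (y : E)) := by
      rw [h3, sub_smul]; abel
    rw [h4, h2', h3]

theorem IsResolventAt.smul_apply_of_apply_sub {T : E →ₗ.[ℂ] E} {z₀ : ℂ} {R₀ : E →L[ℂ] E}
    (h₀ : IsResolventAt T z₀ R₀) (z : ℂ) (y : T.domain) :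
    (y : E) - (z - z₀) • R₀ y = R₀ (T y - z • (y : E)) := by
  have h3 := h₀.left_inv y
  have h4 : T y - z • (y : E) = (T y - z₀ • (y : E)) - (z - z₀) • (y : E) := by
    rw [sub_smul]; abel
  rw [h4, map_sub, h3, map_smul]

/-- On the domain 1 - (z - z₀)R₀ equals R₀(T - z). As R₀ commutes with powers of the left side, each
application lowers the exponent by one. -/
theorem IsResolventAt.kerPow_le {T : E →ₗ.[ℂ] E} {z₀ z : ℂ} {R₀ : E →L[ℂ] E}
    (h₀ : IsResolventAt T z₀ R₀) (n : ℕ) :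
    ∀ y ∈ kerPow T z n, ((1 - (z - z₀) • R₀) ^ n) y = 0 := by
  induction n with
  | zero => intro y hy; simpa [kerPow] using hy
  | succ n ih =>
    rintro _ ⟨y, hy, rfl⟩
    have h1 : (T y - z • (y : E)) ∈ kerPow T z n := hy
    have hc : Commute ((1 - (z - z₀) • R₀) ^ n) R₀ :=
      (((Commute.one_left R₀).sub_left ((Commute.refl R₀).smul_left _))).pow_left n
    rw [pow_succ]
    change ((1 - (z - z₀) • R₀) ^ n) ((y : E) - (z - z₀) • R₀ y) = 0
    rw [h₀.smul_apply_of_apply_sub]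
    have := congrArg (fun S : E →L[ℂ] E => S (T y - z • (y : E))) hc.eq
    change ((1 - (z - z₀) • R₀) ^ n) (R₀ (T y - z • (y : E))) = R₀ _ at this
    exact this.trans ((congrArg R₀ (ih _ h1)).trans (map_zero R₀))

/-- R₀ - (z - z₀)⁻¹ is a nonzero multiple of 1 - (z - z₀)R₀. Only this inclusion is needed to bound
the algebraic multiplicity. -/
theorem IsResolventAt.rootSpace_le {T : E →ₗ.[ℂ] E} {z₀ z : ℂ} {R₀ : E →L[ℂ] E}
    (h₀ : IsResolventAt T z₀ R₀) (hz : z ≠ z₀) :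
    rootSpace T z ≤ Module.End.maxGenEigenspace (R₀ : E →ₗ[ℂ] E) (z - z₀)⁻¹ := by
  refine iSup_le fun n y hy => ?_
  rw [Module.End.mem_maxGenEigenspace]
  refine ⟨n, ?_⟩
  have h1 := h₀.kerPow_le n y hy
  have hz' : z - z₀ ≠ 0 := sub_ne_zero.2 hz
  have h2 : (R₀ - (z - z₀)⁻¹ • (1 : E →L[ℂ] E)) = (-(z - z₀)⁻¹) • (1 - (z - z₀) • R₀) := by
    rw [smul_sub, smul_smul, neg_mul, inv_mul_cancel₀ hz']
    module
  have h3 : (R₀ - (z - z₀)⁻¹ • (1 : E →L[ℂ] E)) ^ n =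
      (-(z - z₀)⁻¹) ^ n • (1 - (z - z₀) • R₀) ^ n := by
    rw [h2, smul_pow]
  have h4 : ((R₀ - (z - z₀)⁻¹ • (1 : E →L[ℂ] E)) ^ n) y = 0 := by
    rw [h3]
    change (-(z - z₀)⁻¹) ^ n • ((1 - (z - z₀) • R₀) ^ n) y = 0
    rw [h1, smul_zero]
  rw [← h4]
  change ((((R₀ - (z - z₀)⁻¹ • (1 : E →L[ℂ] E) : E →L[ℂ] E) : E →ₗ[ℂ] E)) ^ n : E →ₗ[ℂ] E) y = _
  rw [← ContinuousLinearMap.toLinearMap_pow]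
  rfl

variable [CompleteSpace E]

/-- The Fredholm alternative for an unbounded operator with compact resolvent. -/
theorem IsResolventAt.hasEigenvalue_of_mem_spectrum {T : E →ₗ.[ℂ] E} {z₀ z : ℂ} {R₀ : E →L[ℂ] E}
    (h₀ : IsResolventAt T z₀ R₀) (hc : IsCompactOperator R₀) (hz : z ∈ unboundedSpectrum T) :
    z ≠ z₀ ∧ Module.End.HasEigenvalue (R₀ : Module.End ℂ E) (z - z₀)⁻¹ := by
  have hne : z ≠ z₀ := by
    rintro rfl
    exact hz ⟨R₀, h₀⟩
  have hz' : z - z₀ ≠ 0 := sub_ne_zero.2 hne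
  refine ⟨hne, (hc.hasEigenvalue_or_mem_resolventSet (inv_ne_zero hz')).resolve_right fun h => hz ?_⟩
  rw [spectrum.mem_resolventSet_iff] at h
  obtain ⟨u, hu⟩ := h
  have hS : 1 - (z - z₀) • R₀ = (z - z₀) • (u : E →L[ℂ] E) := by
    rw [hu, smul_sub, Algebra.algebraMap_eq_smul_one, smul_smul, mul_inv_cancel₀ hz', one_smul]
  refine ⟨R₀ * ((z - z₀)⁻¹ • (↑u⁻¹ : E →L[ℂ] E)), h₀.of_isUnit ?_ ?_⟩
  · rw [hS, smul_mul_smul_comm, mul_inv_cancel₀ hz', u.mul_inv, one_smul]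
  · rw [hS, smul_mul_smul_comm, inv_mul_cancel₀ hz', u.inv_mul, one_smul]

theorem IsResolventAt.isUnboundedEigenvalue {T : E →ₗ.[ℂ] E} {z₀ z : ℂ} {R₀ : E →L[ℂ] E}
    (h₀ : IsResolventAt T z₀ R₀) (hc : IsCompactOperator R₀) (hz : z ∈ unboundedSpectrum T) :
    IsUnboundedEigenvalue T z := by
  obtain ⟨hne, hev⟩ := h₀.hasEigenvalue_of_mem_spectrum hc hz
  obtain ⟨x, hx⟩ := hev.exists_hasEigenvector
  have hx1 : R₀ x = (z - z₀)⁻¹ • x := hx.apply_eq_smul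
  have hz' : z - z₀ ≠ 0 := sub_ne_zero.2 hne
  refine ⟨⟨R₀ x, h₀.mem_domain x⟩, fun h => ?_, ?_⟩
  · have h' : R₀ x = 0 := congrArg Subtype.val h
    rw [hx1] at h'
    exact hx.2 ((smul_eq_zero.1 h').resolve_left (inv_ne_zero hz'))
  · rw [h₀.apply_eq]
    have : x = (z - z₀) • R₀ x := by rw [hx1, smul_inv_smul₀ hz']
    nth_rewrite 1 [this]
    rw [sub_smul]
    abel

theorem IsResolventAt.finite_spectrum_inter_closedBall {T : E →ₗ.[ℂ] E} {z₀ : ℂ} {R₀ : E →L[ℂ] E}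
    (h₀ : IsResolventAt T z₀ R₀) (hc : IsCompactOperator R₀) (r : ℝ) :
    (unboundedSpectrum T ∩ Metric.closedBall 0 r).Finite := by
  -- For |z| ≤ r one has |z - z₀| ≤ |r| + |z₀|, so (z - z₀)⁻¹ stays outside a fixed disc; the extra
  -- 1 keeps the radius positive.
  have hfin := hc.finite_setOf_hasEigenvalue (ε := (|r| + ‖z₀‖ + 1)⁻¹) (by positivity)
  refine Set.Finite.of_injOn (f := fun z => (z - z₀)⁻¹) (fun z hz => ?_) ?_ hfin
  · obtain ⟨hne, hev⟩ := h₀.hasEigenvalue_of_mem_spectrum hc hz.1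
    refine ⟨?_, hev⟩
    rw [norm_inv]
    have h1 : ‖z‖ ≤ r := by simpa using hz.2
    have h2 := norm_sub_le z z₀
    have h3 := le_abs_self r
    exact inv_anti₀ (norm_pos_iff.2 (sub_ne_zero.2 hne)) (by linarith)
  · intro z _ w _ h
    exact sub_left_injective (inv_injective h)

theorem IsResolventAt.finiteDimensional_rootSpace {T : E →ₗ.[ℂ] E} {z₀ z : ℂ} {R₀ : E →L[ℂ] E}
    (h₀ : IsResolventAt T z₀ R₀) (hc : IsCompactOperator R₀) (hz : z ∈ unboundedSpectrum T) :
    FiniteDimensional ℂ (rootSpace T z) := by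
  have hne := (h₀.hasEigenvalue_of_mem_spectrum hc hz).1
  have := hc.finiteDimensional_maxGenEigenspace (inv_ne_zero (sub_ne_zero.2 hne))
  exact Submodule.finiteDimensional_of_le (h₀.rootSpace_le hne)

end CompactResolvent

/-- One Hilbert–Schmidt resolvent suffices: the resolvent identity R = R₀ + (z - z₀)RR₀ carries
summability, in the same basis, to every other one. -/
theorem unbounded_discrete_spectrum_of_isResolventAt {E : Type} [NormedAddCommGroup E]
    [InnerProductSpace ℂ E] [CompleteSpace E] {T : E →ₗ.[ℂ] E} {z₀ : ℂ} {R₀ : E →L[ℂ] E}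
    (h₀ : IsResolventAt T z₀ R₀) (hHS : IsHilbertSchmidt R₀) :
    (unboundedResolventSet T).Nonempty ∧
    (∀ (z : ℂ) (R : E →L[ℂ] E), IsResolventAt T z R →
      IsCompactOperator R ∧ IsHilbertSchmidt R) ∧
    (∀ r : ℝ, (unboundedSpectrum T ∩ Metric.closedBall 0 r).Finite) ∧
    (∀ z ∈ unboundedSpectrum T,
      IsUnboundedEigenvalue T z ∧ FiniteDimensional ℂ (rootSpace T z)) := by
  obtain ⟨ι, e, he⟩ := hHS
  have hc := isCompactOperator_of_summable_sq_norm e he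
  refine ⟨⟨z₀, R₀, h₀⟩, fun z R h => ?_, h₀.finite_spectrum_inter_closedBall hc, fun z hz =>
    ⟨h₀.isUnboundedEigenvalue hc hz, h₀.finiteDimensional_rootSpace hc hz⟩⟩
  have hR : Summable fun i => ‖R (e i)‖ ^ 2 := by
    rw [h₀.eq_add_smul_mul h]
    exact e.summable_sq_norm_add he (e.summable_sq_norm_comp_left he _)
  exact ⟨isCompactOperator_of_summable_sq_norm e hR, ι, e, hR⟩

/-! ### Absolutely continuous functions with values in a normed space -/

section AbsolutelyContinuous

variable {F G : Type*} [NormedAddCommGroup F] [NormedAddCommGroup G]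

/-- Lets vector-valued statements be reduced to real ones: integrals are compared with integrals of
norms, and real and imaginary parts with the function itself. -/
theorem AbsolutelyContinuousOnInterval.of_dist_le {f : ℝ → F} {g : ℝ → G} {a b : ℝ}
    (hg : AbsolutelyContinuousOnInterval g a b)
    (h : ∀ x ∈ uIcc a b, ∀ y ∈ uIcc a b, dist (f x) (f y) ≤ dist (g x) (g y)) :
    AbsolutelyContinuousOnInterval f a b := by
  rw [absolutelyContinuousOnInterval_iff] at hg ⊢
  intro ε hε
  obtain ⟨δ, hδ, H⟩ := hg ε hε
  refine ⟨δ, hδ, fun I hI hI' => lt_of_le_of_lt (Finset.sum_le_sum fun i hi => ?_) (H I hI hI')⟩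
  exact h _ (hI.1 i hi).1 _ (hI.1 i hi).2

theorem AbsolutelyContinuousOnInterval.congr_eqOn {f g : ℝ → F} {a b : ℝ}
    (hg : AbsolutelyContinuousOnInterval g a b) (h : EqOn f g (uIcc a b)) :
    AbsolutelyContinuousOnInterval f a b :=
  hg.of_dist_le fun x hx y hy => by rw [h hx, h hy]

theorem absolutelyContinuousOnInterval_const (c : F) (a b : ℝ) :
    AbsolutelyContinuousOnInterval (fun _ : ℝ => c) a b :=
  (LipschitzWith.const c).lipschitzOnWith.absolutelyContinuousOnInterval

theorem IntervalIntegrable.absolutelyContinuousOnInterval_integral [NormedSpace ℝ F] {f : ℝ → F}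
    {a b c : ℝ} (h : IntervalIntegrable f volume a b) (hc : c ∈ uIcc a b) :
    AbsolutelyContinuousOnInterval (fun x => ∫ v in c..x, f v) a b := by
  refine (h.norm.absolutelyContinuousOnInterval_intervalIntegral hc).of_dist_le
    fun x hx y hy => ?_
  have hcx : IntervalIntegrable f volume c x := h.mono_set (uIcc_subset_uIcc hc hx)
  have hcy : IntervalIntegrable f volume c y := h.mono_set (uIcc_subset_uIcc hc hy)
  rw [dist_eq_norm, dist_eq_norm, intervalIntegral.integral_interval_sub_left hcx hcy,
    intervalIntegral.integral_interval_sub_left hcx.norm hcy.norm]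
  exact intervalIntegral.norm_integral_le_abs_integral_norm

theorem AbsolutelyContinuousOnInterval.ae_differentiableAt_complex {f : ℝ → ℂ} {a b : ℝ}
    (hf : AbsolutelyContinuousOnInterval f a b) :
    ∀ᵐ x : ℝ, x ∈ uIcc a b → DifferentiableAt ℝ f x :=
  hf.boundedVariationOn.ae_differentiableAt_of_mem_uIcc

theorem AbsolutelyContinuousOnInterval.intervalIntegrable_deriv_complex {f : ℝ → ℂ} {a b : ℝ}
    (hf : AbsolutelyContinuousOnInterval f a b) : IntervalIntegrable (deriv f) volume a b := by
  have hre : AbsolutelyContinuousOnInterval (fun x => (f x).re) a b :=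
    hf.of_dist_le fun x _ y _ => by
      rw [Real.dist_eq, dist_eq_norm, ← Complex.sub_re]; exact Complex.abs_re_le_norm _
  have him : AbsolutelyContinuousOnInterval (fun x => (f x).im) a b :=
    hf.of_dist_le fun x _ y _ => by
      rw [Real.dist_eq, dist_eq_norm, ← Complex.sub_im]; exact Complex.abs_im_le_norm _
  have hof : ∀ {g : ℝ → ℝ}, IntervalIntegrable g volume a b →
      IntervalIntegrable (fun x => (g x : ℂ)) volume a b := fun h => ⟨h.1.ofReal, h.2.ofReal⟩
  have h1 := (hof hre.intervalIntegrable_deriv).add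
    ((hof him.intervalIntegrable_deriv).mul_const Complex.I)
  refine h1.congr_ae ?_
  rw [Filter.EventuallyEq, ae_restrict_iff' measurableSet_uIoc]
  filter_upwards [hf.ae_differentiableAt_complex] with x hx hxm
  have hd := (hx (uIoc_subset_uIcc hxm)).hasDerivAt
  have hr : HasDerivAt (fun x => (f x).re) (deriv f x).re x :=
    Complex.reCLM.hasFDerivAt.comp_hasDerivAt x hd
  have hi : HasDerivAt (fun x => (f x).im) (deriv f x).im x :=
    Complex.imCLM.hasFDerivAt.comp_hasDerivAt x hd
  simp only [hr.deriv, hi.deriv]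
  exact Complex.re_add_im _

/-- Subtracting the primitive of f' leaves an absolutely continuous function with zero derivative
a.e., hence a constant. -/
theorem AbsolutelyContinuousOnInterval.integral_deriv_eq_sub_complex {f : ℝ → ℂ} {a b : ℝ}
    (hf : AbsolutelyContinuousOnInterval f a b) : ∫ x in a..b, deriv f x = f b - f a := by
  have hint := hf.intervalIntegrable_deriv_complex
  have hac := hf.sub (hint.absolutelyContinuousOnInterval_integral (c := a) (by simp))
  have h0 : ∀ᵐ x, x ∈ uIcc a b → HasDerivAt (f - fun x => ∫ t in a..x, deriv f t) 0 x := by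
    filter_upwards [hf.ae_differentiableAt_complex, hint.ae_hasDerivAt_integral] with x h1 h2 hx
    simpa using (h1 hx).hasDerivAt.sub (h2 hx a (by simp))
  obtain ⟨C, hC⟩ := hac.const_of_ae_hasDerivAt_zero h0
  have h1 := hC a (by simp)
  have h2 := hC b (by simp)
  simp only [Pi.sub_apply, intervalIntegral.integral_same, sub_zero] at h1 h2
  rw [h1, ← h2]; ring

theorem AbsolutelyContinuousOnInterval.comp_neg {f : ℝ → ℂ} {a b : ℝ}
    (hf : AbsolutelyContinuousOnInterval f a b) :
    AbsolutelyContinuousOnInterval (fun x => f (-x)) (-a) (-b) := by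
  have hint : IntervalIntegrable (fun t => deriv f (-t)) volume (-a) (-b) := by
    exact (IntervalIntegrable.iff_comp_neg (by simp)).1 hf.intervalIntegrable_deriv_complex
  refine ((absolutelyContinuousOnInterval_const (f a) (-a) (-b)).sub
    (hint.absolutelyContinuousOnInterval_integral (c := -a) (by simp))).congr_eqOn fun x hx => ?_
  have hx' : -x ∈ uIcc a b := by
    rw [mem_uIcc] at hx ⊢
    rcases hx with h | h
    · exact Or.inr ⟨by linarith [h.2], by linarith [h.1]⟩
    · exact Or.inl ⟨by linarith [h.2], by linarith [h.1]⟩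
  have h1 := (hf.mono (uIcc_subset_uIcc left_mem_uIcc hx')).integral_deriv_eq_sub_complex
  simp only [Pi.sub_apply]
  rw [intervalIntegral.integral_comp_neg (fun t => deriv f t), neg_neg,
    intervalIntegral.integral_symm, h1]
  ring

end AbsolutelyContinuous

/-! ### The integrating factor -/

noncomputable section

/-- An integrating factor of the first order expression: on `(0, π)` its logarithmic derivative is
`(1 - a cos x) / (b sin x)`. -/
def integratingFactor (a b x : ℝ) : ℝ :=
  |Real.sin (x / 2)| ^ ((1 - a) / b) * Real.cos (x / 2) ^ (-((1 + a) / b))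

/-- The integrating factor divided by the leading coefficient `b sin x`. -/
def solutionKernel (a b x : ℝ) : ℝ :=
  integratingFactor a b x / (b * Real.sin x)

section IntegratingFactor

variable {a b : ℝ}

theorem one_sub_mul_cos_pos (ha : 0 < a) (ha1 : a < 1) (x : ℝ) : 0 < 1 - a * Real.cos x := by
  nlinarith [Real.cos_le_one x]

theorem one_sub_le_one_sub_mul_cos (ha : 0 < a) (x : ℝ) : 1 - a ≤ 1 - a * Real.cos x := by
  nlinarith [Real.cos_le_one x]

theorem one_sub_mul_cos_le (ha : 0 < a) (x : ℝ) : 1 - a * Real.cos x ≤ 1 + a := by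
  nlinarith [Real.neg_one_le_cos x]

theorem integratingFactor_neg (x : ℝ) : integratingFactor a b (-x) = integratingFactor a b x := by
  simp [integratingFactor, neg_div]

theorem solutionKernel_neg (x : ℝ) : solutionKernel a b (-x) = -solutionKernel a b x := by
  simp [solutionKernel, integratingFactor_neg, div_neg]

theorem integratingFactor_zero (hb : 0 < b) (ha1 : a < 1) : integratingFactor a b 0 = 0 := by
  have : (1 - a) / b ≠ 0 := (div_pos (sub_pos.2 ha1) hb).ne'
  simp [integratingFactor, Real.zero_rpow this]

/-- The true limit at π is +∞. The convention that 0 to a negative power is 0 makes the reciprocal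
at π equal 0, which is the correct limit of 1/p. -/
theorem integratingFactor_pi (ha : 0 < a) (hb : 0 < b) : integratingFactor a b Real.pi = 0 := by
  have : -((1 + a) / b) ≠ 0 := neg_ne_zero.2 (by positivity)
  simp [integratingFactor, Real.zero_rpow this]

theorem sin_half_pos {x : ℝ} (hx : x ∈ Ioc 0 Real.pi) : 0 < Real.sin (x / 2) :=
  Real.sin_pos_of_pos_of_lt_pi (by linarith [hx.1]) (by linarith [hx.2, Real.pi_pos])

theorem cos_half_pos {x : ℝ} (hx : x ∈ Ico 0 Real.pi) : 0 < Real.cos (x / 2) :=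
  Real.cos_pos_of_mem_Ioo ⟨by linarith [hx.1, Real.pi_pos], by linarith [hx.2]⟩

theorem integratingFactor_pos {x : ℝ} (hx : x ∈ Ioo 0 Real.pi) : 0 < integratingFactor a b x :=
  mul_pos (Real.rpow_pos_of_pos (abs_pos.2 (sin_half_pos ⟨hx.1, hx.2.le⟩).ne') _)
    (Real.rpow_pos_of_pos (cos_half_pos ⟨hx.1.le, hx.2⟩) _)

theorem solutionKernel_pos (hb : 0 < b) {x : ℝ} (hx : x ∈ Ioo 0 Real.pi) :
    0 < solutionKernel a b x :=
  div_pos (integratingFactor_pos hx) (mul_pos hb (Real.sin_pos_of_mem_Ioo hx))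

theorem mul_sin_mul_solutionKernel (hb : 0 < b) {x : ℝ} (hx : x ∈ Ioo 0 Real.pi) :
    b * Real.sin x * solutionKernel a b x = integratingFactor a b x :=
  mul_div_cancel₀ _ (mul_pos hb (Real.sin_pos_of_mem_Ioo hx)).ne'

/-- In half angles m = (1 - a)cos²(x/2) + (1 + a)sin²(x/2) and sin x = 2 sin(x/2)cos(x/2). Thus m/(b
sin x) splits into multiples of cot(x/2) and tan(x/2), the logarithmic derivatives of the two
powers. -/
theorem hasDerivAt_integratingFactor (hb : 0 < b) {x : ℝ} (hx : x ∈ Ioo 0 Real.pi) :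
    HasDerivAt (integratingFactor a b) ((1 - a * Real.cos x) * solutionKernel a b x) x := by
  have hs := sin_half_pos ⟨hx.1, hx.2.le⟩
  have hc := cos_half_pos ⟨hx.1.le, hx.2⟩
  have hd : HasDerivAt (fun y : ℝ => y / 2) (1 / 2) x := (hasDerivAt_id x).div_const 2
  have h1 := (hd.sin).rpow_const (p := (1 - a) / b) (Or.inl hs.ne')
  have h2 := (hd.cos).rpow_const (p := -((1 + a) / b)) (Or.inl hc.ne')
  have h3 := h1.mul h2
  have heq : integratingFactor a b =ᶠ[𝓝 x] fun y =>
      Real.sin (y / 2) ^ ((1 - a) / b) * Real.cos (y / 2) ^ (-((1 + a) / b)) := by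
    filter_upwards [isOpen_Ioo.mem_nhds hx] with y hy
    rw [integratingFactor, abs_of_pos (sin_half_pos ⟨hy.1, hy.2.le⟩)]
  refine (h3.congr_of_eventuallyEq heq).congr_deriv ?_
  have e1 : Real.sin x = 2 * Real.sin (x / 2) * Real.cos (x / 2) := by
    rw [← Real.sin_two_mul]; congr 1; ring
  have e2 : 1 - a * Real.cos x
      = (1 - a) * Real.cos (x / 2) ^ 2 + (1 + a) * Real.sin (x / 2) ^ 2 := by
    have : Real.cos x = Real.cos (x / 2) ^ 2 - Real.sin (x / 2) ^ 2 := by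
      rw [← Real.cos_two_mul']; congr 1; ring
    rw [this]; nlinarith [Real.sin_sq_add_cos_sq (x / 2)]
  rw [solutionKernel, integratingFactor, e2, e1, abs_of_pos hs, Real.rpow_sub_one hs.ne',
    Real.rpow_sub_one hc.ne']
  field_simp

theorem continuousOn_integratingFactor (hb : 0 < b) (ha1 : a < 1) :
    ContinuousOn (integratingFactor a b) (Ico 0 Real.pi) := by
  refine ContinuousOn.mul ?_ ?_
  · refine Continuous.continuousOn (Continuous.rpow_const (by fun_prop) fun x => Or.inr ?_)
    exact (div_pos (sub_pos.2 ha1) hb).le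
  · exact ContinuousOn.rpow_const (by fun_prop) fun x hx => Or.inl (cos_half_pos hx).ne'

theorem continuousOn_inv_integratingFactor (ha : 0 < a) (hb : 0 < b) :
    ContinuousOn (fun x => (integratingFactor a b x)⁻¹) (Ioc 0 Real.pi) := by
  have h : ∀ x ∈ Ioc 0 Real.pi, (integratingFactor a b x)⁻¹ =
      Real.sin (x / 2) ^ (-((1 - a) / b)) * Real.cos (x / 2) ^ ((1 + a) / b) := fun x hx => by
    have hs := sin_half_pos hx
    have hc : 0 ≤ Real.cos (x / 2) :=
      Real.cos_nonneg_of_mem_Icc ⟨by linarith [hx.1, Real.pi_pos], by linarith [hx.2]⟩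
    rw [integratingFactor, abs_of_pos hs, mul_inv, ← Real.rpow_neg hs.le, ← Real.rpow_neg hc,
      neg_neg]
  refine ContinuousOn.congr (ContinuousOn.mul ?_ ?_) h
  · exact ContinuousOn.rpow_const (by fun_prop) fun x hx => Or.inl (sin_half_pos hx).ne'
  · exact Continuous.continuousOn
      (Continuous.rpow_const (by fun_prop) fun x => Or.inr (by positivity))

theorem measurable_integratingFactor : Measurable (integratingFactor a b) := by
  unfold integratingFactor
  fun_prop

theorem measurable_solutionKernel : Measurable (solutionKernel a b) := by
  unfold solutionKernel
  exact measurable_integratingFactor.div (by fun_prop)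

/-- The integrand may be singular at 0, but it is the nonnegative derivative of a function
continuous up to 0. -/
theorem intervalIntegrable_deriv_integratingFactor (ha : 0 < a) (hb : 0 < b) (ha1 : a < 1) {x : ℝ}
    (hx : x ∈ Ico 0 Real.pi) :
    IntervalIntegrable (fun t => (1 - a * Real.cos t) * solutionKernel a b t) volume 0 x := by
  have hsub : ∀ t ∈ Ioo 0 x, t ∈ Ioo 0 Real.pi := fun t ht => ⟨ht.1, ht.2.trans hx.2⟩
  refine intervalIntegral.intervalIntegrable_deriv_of_nonneg (g := integratingFactor a b) ?_ ?_ ?_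
  · rw [uIcc_of_le hx.1]
    exact (continuousOn_integratingFactor hb ha1).mono fun t ht => ⟨ht.1, ht.2.trans_lt hx.2⟩
  · rw [min_eq_left hx.1, max_eq_right hx.1]
    exact fun t ht => hasDerivAt_integratingFactor hb (hsub t ht)
  · rw [min_eq_left hx.1, max_eq_right hx.1]
    exact fun t ht => mul_nonneg (one_sub_mul_cos_pos ha ha1 t).le
      (solutionKernel_pos hb (hsub t ht)).le

theorem integral_deriv_integratingFactor (ha : 0 < a) (hb : 0 < b) (ha1 : a < 1) {x : ℝ}
    (hx : x ∈ Ico 0 Real.pi) :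
    ∫ t in (0 : ℝ)..x, (1 - a * Real.cos t) * solutionKernel a b t = integratingFactor a b x := by
  rw [intervalIntegral.integral_eq_sub_of_hasDerivAt_of_le hx.1
    ((continuousOn_integratingFactor hb ha1).mono fun t ht => ⟨ht.1, ht.2.trans_lt hx.2⟩)
    (fun t ht => hasDerivAt_integratingFactor hb ⟨ht.1, ht.2.trans hx.2⟩)
    (intervalIntegrable_deriv_integratingFactor ha hb ha1 hx), integratingFactor_zero hb ha1,
    sub_zero]

theorem absolutelyContinuousOnInterval_integratingFactor (ha : 0 < a) (hb : 0 < b) (ha1 : a < 1)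
    {x : ℝ} (hx : x ∈ Ico 0 Real.pi) :
    AbsolutelyContinuousOnInterval (integratingFactor a b) 0 x := by
  refine ((intervalIntegrable_deriv_integratingFactor ha hb ha1
    hx).absolutelyContinuousOnInterval_integral left_mem_uIcc).congr_eqOn fun t ht => ?_
  rw [uIcc_of_le hx.1] at ht
  exact (integral_deriv_integratingFactor ha hb ha1 ⟨ht.1, ht.2.trans_lt hx.2⟩).symm

theorem intervalIntegrable_solutionKernel (ha : 0 < a) (hb : 0 < b) (ha1 : a < 1) {x : ℝ}
    (hx : x ∈ Ico 0 Real.pi) : IntervalIntegrable (solutionKernel a b) volume 0 x := by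
  have h := (intervalIntegrable_deriv_integratingFactor ha hb ha1 hx).continuousOn_mul
    (g := fun t => (1 - a * Real.cos t)⁻¹)
    (Continuous.continuousOn (Continuous.inv₀ (by fun_prop)
      fun t => (one_sub_mul_cos_pos ha ha1 t).ne'))
  refine h.congr fun t _ => ?_
  exact inv_mul_cancel_left₀ (one_sub_mul_cos_pos ha ha1 t).ne' _

end IntegratingFactor

end

/-! ### Solving the first order equation on a half interval -/

noncomputable section

section HalfInterval

variable {a b : ℝ}

/-- The derivative of minus the reciprocal of the integrating factor. -/
def derivNegInvIntegratingFactor (a b x : ℝ) : ℝ :=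
  (1 - a * Real.cos x) * solutionKernel a b x / integratingFactor a b x ^ 2

theorem measurable_derivNegInvIntegratingFactor : Measurable (derivNegInvIntegratingFactor a b) := by
  unfold derivNegInvIntegratingFactor
  exact (Measurable.mul (by fun_prop) measurable_solutionKernel).div
    (measurable_integratingFactor.pow_const 2)

theorem derivNegInvIntegratingFactor_nonneg (ha : 0 < a) (hb : 0 < b) (ha1 : a < 1) {x : ℝ}
    (hx : x ∈ Ioo 0 Real.pi) : 0 ≤ derivNegInvIntegratingFactor a b x :=
  div_nonneg (mul_nonneg (one_sub_mul_cos_pos ha ha1 x).le (solutionKernel_pos hb hx).le)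
    (sq_nonneg _)

theorem integrableOn_and_integral_derivNegInv (ha : 0 < a) (hb : 0 < b) (ha1 : a < 1) {t x : ℝ}
    (ht : 0 < t) (htx : t ≤ x) (hx : x ≤ Real.pi) :
    IntegrableOn (derivNegInvIntegratingFactor a b) (Ioo t x) ∧
    ∫ s in Ioo t x, derivNegInvIntegratingFactor a b s =
      (integratingFactor a b t)⁻¹ - (integratingFactor a b x)⁻¹ := by
  have hsub : ∀ s ∈ Ioo t x, s ∈ Ioo 0 Real.pi := fun s hs =>
    ⟨ht.trans hs.1, hs.2.trans_le hx⟩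
  have hcont : ContinuousOn (fun x => -(integratingFactor a b x)⁻¹) (Icc t x) :=
    ((continuousOn_inv_integratingFactor ha hb).mono fun s hs =>
      ⟨ht.trans_le hs.1, hs.2.trans hx⟩).neg
  have hderiv : ∀ s ∈ Ioo t x, HasDerivAt (fun x => -(integratingFactor a b x)⁻¹)
      (derivNegInvIntegratingFactor a b s) s := fun s hs => by
    refine ((hasDerivAt_integratingFactor hb (hsub s hs)).inv
      (integratingFactor_pos (hsub s hs)).ne').neg.congr_deriv ?_
    rw [derivNegInvIntegratingFactor]; ring
  have hint := intervalIntegral.integrableOn_deriv_of_nonneg hcont hderiv fun s hs =>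
    derivNegInvIntegratingFactor_nonneg ha hb ha1 (hsub s hs)
  refine ⟨hint.mono_set Ioo_subset_Ioc_self, ?_⟩
  rw [← integral_Ioc_eq_integral_Ioo, ← intervalIntegral.integral_of_le htx,
    intervalIntegral.integral_eq_sub_of_hasDerivAt_of_le htx hcont hderiv
      ((intervalIntegrable_iff_integrableOn_Ioc_of_le htx).2 hint)]
  ring

/-- The derivative of the solution of the first order equation whose right-hand side is
`(1 - a cos x) q(x)` with `q' = g`. -/
def solutionDeriv (a b : ℝ) (g : ℝ → ℂ) (s : ℝ) : ℂ :=
  derivNegInvIntegratingFactor a b s • ∫ t in Ioo 0 s, integratingFactor a b t • g t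

/-- Fubini on the triangle t < s. The inner integral of p'/p² over (t, x) is 1/p(t) - 1/p(x), and
multiplying by p(t) leaves a factor between 0 and 1, so g alone dominates. -/
theorem integrableOn_and_integral_solutionDeriv (ha : 0 < a) (hb : 0 < b) (ha1 : a < 1)
    {g : ℝ → ℂ} {x : ℝ} (hx : x ≤ Real.pi) (hg : IntegrableOn g (Ioo 0 x)) :
    IntegrableOn (solutionDeriv a b g) (Ioo 0 x) ∧
    ∫ s in Ioo 0 x, solutionDeriv a b g s =
      ∫ t in Ioo 0 x, (1 - (integratingFactor a b x)⁻¹ * integratingFactor a b t) • g t := by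
  let μ : Measure ℝ := volume.restrict (Ioo 0 x)
  let φ := derivNegInvIntegratingFactor a b
  let p := integratingFactor a b
  let k : ℝ × ℝ → ℂ := {z : ℝ × ℝ | z.1 < z.2}.indicator fun z => φ z.2 • (p z.1 • g z.1)
  have hk : ∀ t s, k (t, s) = (Ioi t).indicator (fun s => φ s • (p t • g t)) s := fun t s => rfl
  have hset : ∀ t ∈ Ioo 0 x, Ioi t ∩ Ioo 0 x = Ioo t x := fun t ht => by
    ext s
    simp only [mem_inter_iff, mem_Ioi, mem_Ioo]
    exact ⟨fun h => ⟨h.1, h.2.2⟩, fun h => ⟨h.1, ht.1.trans h.1, h.2⟩⟩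
  have hφ : ∀ t ∈ Ioo 0 x, IntegrableOn φ (Ioo t x) ∧ ∫ s in Ioo t x, φ s = (p t)⁻¹ - (p x)⁻¹ :=
    fun t ht => integrableOn_and_integral_derivNegInv ha hb ha1 ht.1 ht.2.le hx
  have hpt : ∀ t ∈ Ioo 0 x, 0 < p t := fun t ht => integratingFactor_pos ⟨ht.1, ht.2.trans_le hx⟩
  have hmul : ∀ t ∈ Ioo 0 x, ((p t)⁻¹ - (p x)⁻¹) * p t = 1 - (p x)⁻¹ * p t := fun t ht => by
    rw [sub_mul, inv_mul_cancel₀ (hpt t ht).ne']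
  have hsec : ∀ t ∈ Ioo 0 x, Integrable (fun s => k (t, s)) μ := fun t ht => by
    simp only [hk]
    rw [integrable_indicator_iff measurableSet_Ioi, IntegrableOn,
      Measure.restrict_restrict measurableSet_Ioi, hset t ht]
    exact (hφ t ht).1.smul_const _
  have hint : ∀ t ∈ Ioo 0 x, ∫ s, k (t, s) ∂μ = (1 - (p x)⁻¹ * p t) • g t := fun t ht => by
    simp only [hk]
    rw [integral_indicator measurableSet_Ioi, Measure.restrict_restrict measurableSet_Ioi,
      hset t ht, integral_smul_const, (hφ t ht).2, smul_smul, hmul t ht]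
  have hnorm : ∀ t ∈ Ioo 0 x, ∫ s, ‖k (t, s)‖ ∂μ = (1 - (p x)⁻¹ * p t) * ‖g t‖ := fun t ht => by
    simp only [hk, norm_indicator_eq_indicator_norm]
    rw [integral_indicator measurableSet_Ioi, Measure.restrict_restrict measurableSet_Ioi,
      hset t ht]
    have : ∀ s ∈ Ioo t x, ‖φ s • (p t • g t)‖ = φ s * (p t * ‖g t‖) := fun s hs => by
      rw [norm_smul, norm_smul, Real.norm_of_nonneg (hpt t ht).le, Real.norm_of_nonneg]
      exact derivNegInvIntegratingFactor_nonneg ha hb ha1 ⟨ht.1.trans hs.1, hs.2.trans_le hx⟩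
    rw [setIntegral_congr_fun measurableSet_Ioo this, integral_mul_const, (hφ t ht).2,
      ← mul_assoc, hmul t ht]
  have hmeas : AEStronglyMeasurable k (μ.prod μ) := by
    refine AEStronglyMeasurable.indicator ?_ (measurableSet_lt measurable_fst measurable_snd)
    exact (measurable_derivNegInvIntegratingFactor.comp measurable_snd).aestronglyMeasurable.smul
      ((measurable_integratingFactor.comp measurable_fst).aestronglyMeasurable.smul hg.1.comp_fst)
  have hprod : Integrable k (μ.prod μ) := by
    rw [integrable_prod_iff hmeas]
    refine ⟨(ae_restrict_iff' measurableSet_Ioo).2 (Eventually.of_forall hsec), ?_⟩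
    have h1 : Integrable (fun t => ‖g t‖) μ := hg.norm
    refine h1.mono' (hmeas.norm.integral_prod_right') ?_
    refine (ae_restrict_iff' measurableSet_Ioo).2 (Eventually.of_forall fun t ht => ?_)
    rw [hnorm t ht, norm_mul, norm_norm]
    refine mul_le_of_le_one_left (norm_nonneg _) ?_
    have hnn : 0 ≤ (p t)⁻¹ - (p x)⁻¹ := by
      rw [← (hφ t ht).2]
      exact setIntegral_nonneg measurableSet_Ioo fun s hs =>
        derivNegInvIntegratingFactor_nonneg ha hb ha1 ⟨ht.1.trans hs.1, hs.2.trans_le hx⟩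
    rw [Real.norm_of_nonneg (by rw [← hmul t ht]; exact mul_nonneg hnn (hpt t ht).le)]
    have : 0 ≤ p x := mul_nonneg (Real.rpow_nonneg (abs_nonneg _) _)
      (Real.rpow_nonneg (Real.cos_nonneg_of_mem_Icc
        ⟨by linarith [ht.1, ht.2, Real.pi_pos], by linarith⟩) _)
    have := mul_nonneg (inv_nonneg.2 this) (hpt t ht).le
    linarith
  have hv : ∀ s ∈ Ioo 0 x, ∫ t, k (t, s) ∂μ = solutionDeriv a b g s := fun s hs => by
    have : ∀ t, k (t, s) = (Iio s).indicator (fun t => φ s • (p t • g t)) t := fun t => rfl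
    simp only [this]
    rw [integral_indicator measurableSet_Iio, Measure.restrict_restrict measurableSet_Iio,
      integral_smul]
    have : Iio s ∩ Ioo 0 x = Ioo 0 s := by
      ext t
      simp only [mem_inter_iff, mem_Iio, mem_Ioo]
      exact ⟨fun h => ⟨h.2.1, h.1⟩, fun h => ⟨h.2, h.1, h.2.trans hs.2⟩⟩
    rw [this]; rfl
  constructor
  · exact (hprod.integral_prod_right).congr
      ((ae_restrict_iff' measurableSet_Ioo).2 (Eventually.of_forall hv))
  · rw [← setIntegral_congr_fun measurableSet_Ioo hv, ← setIntegral_congr_fun measurableSet_Ioo hint]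
    exact (integral_integral_swap (f := fun t s => k (t, s)) hprod).symm

/-- For absolutely continuous `q`, the equation `b sin x · y' + (1 - a cos x) y = (1 - a cos x) q`
has an absolutely continuous solution on `[0, π]` with `y(0) = q(0)` and `y(π) = q(π)`. -/
theorem exists_intervalIntegrable_solution (ha : 0 < a) (hb : 0 < b) (ha1 : a < 1) {q : ℝ → ℂ}
    (hq : AbsolutelyContinuousOnInterval q 0 Real.pi) :
    ∃ v : ℝ → ℂ, IntervalIntegrable v volume 0 Real.pi ∧
      q 0 + ∫ s in (0 : ℝ)..Real.pi, v s = q Real.pi ∧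
      ∀ x ∈ Ioo 0 Real.pi, (1 - a * Real.cos x) • (q 0 + ∫ s in (0 : ℝ)..x, v s) +
        (b * Real.sin x) • v x = (1 - a * Real.cos x) • q x := by
  have hpi := Real.pi_pos
  have hg0 : IntegrableOn (deriv q) (Ioo 0 Real.pi) :=
    ((intervalIntegrable_iff_integrableOn_Ioc_of_le hpi.le).1
      hq.intervalIntegrable_deriv_complex).mono_set Ioo_subset_Ioc_self
  have hg : ∀ x ≤ Real.pi, IntegrableOn (deriv q) (Ioo 0 x) := fun x hx =>
    hg0.mono_set (Ioo_subset_Ioo_right hx)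
  have hv : ∀ x ∈ Icc 0 Real.pi, ∫ s in (0 : ℝ)..x, solutionDeriv a b (deriv q) s =
      ∫ t in Ioo 0 x, (1 - (integratingFactor a b x)⁻¹ * integratingFactor a b t) • deriv q t :=
    fun x hx => by
      rw [intervalIntegral.integral_of_le hx.1, integral_Ioc_eq_integral_Ioo]
      exact (integrableOn_and_integral_solutionDeriv ha hb ha1 hx.2 (hg x hx.2)).2
  have hftc : ∀ x ∈ Icc 0 Real.pi, ∫ t in Ioo 0 x, deriv q t = q x - q 0 := fun x hx => by
    rw [← integral_Ioc_eq_integral_Ioo, ← intervalIntegral.integral_of_le hx.1]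
    refine (hq.mono (uIcc_subset_uIcc left_mem_uIcc ?_)).integral_deriv_eq_sub_complex
    rwa [uIcc_of_le hpi.le]
  -- Integrating by parts in y = p⁻¹ ∫ p'q gives y = q - p⁻¹ ∫ p q'. Differentiating, the q' terms
  -- cancel and y' = (p'/p²) ∫ p q' remains.
  refine ⟨solutionDeriv a b (deriv q), ?_, ?_, fun x hx => ?_⟩
  · rw [intervalIntegrable_iff_integrableOn_Ioo_of_le hpi.le]
    exact (integrableOn_and_integral_solutionDeriv ha hb ha1 le_rfl hg0).1
  -- At π the term with 1/p drops out, so the integral of v is the full increment of q.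
  · rw [hv _ ⟨hpi.le, le_rfl⟩, integratingFactor_pi ha hb]
    simp only [inv_zero, zero_mul, sub_zero, one_smul]
    rw [hftc _ ⟨hpi.le, le_rfl⟩]; ring
  · have hxI : x ∈ Icc 0 Real.pi := ⟨hx.1.le, hx.2.le⟩
    have hp := integratingFactor_pos (a := a) (b := b) hx
    have hpint : IntegrableOn (fun t => integratingFactor a b t • deriv q t) (Ioo 0 x) := by
      have h := (hq.mono (uIcc_subset_uIcc left_mem_uIcc (by rwa [uIcc_of_le hpi.le]) :
        uIcc 0 x ⊆ uIcc 0 Real.pi)).intervalIntegrable_deriv_complex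
      rw [intervalIntegrable_iff_integrableOn_Icc_of_le hx.1.le] at h
      exact (h.continuousOn_smul ((continuousOn_integratingFactor hb ha1).mono fun t ht =>
        ⟨ht.1, ht.2.trans_lt hx.2⟩) isCompact_Icc).mono_set Ioo_subset_Icc_self
    have h1 : ∫ t in Ioo 0 x, (1 - (integratingFactor a b x)⁻¹ * integratingFactor a b t) •
        deriv q t = q x - q 0 - (integratingFactor a b x)⁻¹ •
          ∫ t in Ioo 0 x, integratingFactor a b t • deriv q t := by
      simp only [sub_smul, one_smul, mul_smul]
      refine (integral_sub (hg x hx.2.le) (hpint.smul (integratingFactor a b x)⁻¹)).trans ?_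
      rw [hftc x hxI]
      simp only [Pi.smul_apply]
      rw [integral_smul]
    rw [hv x hxI, h1, solutionDeriv, smul_smul]
    have h2 : b * Real.sin x * derivNegInvIntegratingFactor a b x =
        (1 - a * Real.cos x) * (integratingFactor a b x)⁻¹ := by
      have h3 := mul_sin_mul_solutionKernel (a := a) hb hx
      rw [derivNegInvIntegratingFactor]
      field_simp
      rw [← h3]; ring
    rw [h2, mul_smul, ← smul_add]
    congr 1
    ring

end HalfInterval

end

/-! ### Solving the first order equation on `(-π, π)` -/

noncomputable section

section FullInterval

variable {a b : ℝ}

theorem exists_absolutelyContinuous_firstOrder_eq (ha : 0 < a) (hb : 0 < b) (ha1 : a < 1)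
    {u : ℝ → ℂ} (hu : AbsolutelyContinuousOnInterval u (-Real.pi) Real.pi) :
    ∃ y : ℝ → ℂ, AbsolutelyContinuousOnInterval y (-Real.pi) Real.pi ∧
      u =ᵐ[intervalMeasure] firstOrder a b y ∧
      (1 + a) • y (-Real.pi) = u (-Real.pi) ∧ (1 + a) • y Real.pi = u Real.pi := by
  have hpi := Real.pi_pos
  have hm : ∀ x, 1 - a * Real.cos x ≠ 0 := fun x => (one_sub_mul_cos_pos ha ha1 x).ne'
  let q : ℝ → ℂ := fun x => (1 - a * Real.cos x)⁻¹ • u x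
  have hmq : ∀ x, (1 - a * Real.cos x) • q x = u x := fun x => smul_inv_smul₀ (hm x) _
  have hqac : AbsolutelyContinuousOnInterval q (-Real.pi) Real.pi := by
    have hd : ContDiff ℝ 1 fun x : ℝ => 1 - a * Real.cos x := by fun_prop
    have hinv : AbsolutelyContinuousOnInterval (fun x => (1 - a * Real.cos x)⁻¹) (-Real.pi)
        Real.pi := (hd.inv hm).contDiffOn.absolutelyContinuousOnInterval
    exact hinv.fun_smul hu
  have hq1 : AbsolutelyContinuousOnInterval q 0 Real.pi :=
    hqac.mono (uIcc_subset_uIcc (by rw [uIcc_of_le (by linarith)]; exact ⟨by linarith, hpi.le⟩)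
      right_mem_uIcc)
  have hq2 : AbsolutelyContinuousOnInterval (fun x => q (-x)) 0 Real.pi := by
    have h := hqac.comp_neg
    rw [neg_neg] at h
    exact h.mono (uIcc_subset_uIcc (by rw [uIcc_of_ge (by linarith)]; exact ⟨by linarith, hpi.le⟩)
      left_mem_uIcc)
  obtain ⟨v₁, hv₁, hπ₁, he₁⟩ := exists_intervalIntegrable_solution ha hb ha1 hq1
  obtain ⟨v₂, hv₂, hπ₂, he₂⟩ := exists_intervalIntegrable_solution ha hb ha1 hq2
  simp only [neg_zero] at hπ₂ he₂
  -- The equation is invariant under x ↦ -x, so the left half is the reflected solution for q(-x).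
  -- Both halves take the value q(0) at 0, so a single primitive of v glues them.
  let v : ℝ → ℂ := fun s => if 0 < s then v₁ s else -v₂ (-s)
  have hvpos : ∀ s, 0 < s → v s = v₁ s := fun s hs => if_pos hs
  have hvneg : ∀ s, s ≤ 0 → v s = -v₂ (-s) := fun s hs => if_neg (not_lt.2 hs)
  have hint₁ : IntervalIntegrable v volume 0 Real.pi := hv₁.congr fun s hs =>
    (hvpos s (by rw [uIoc_of_le hpi.le] at hs; exact hs.1)).symm
  have hint₂ : IntervalIntegrable v volume (-Real.pi) 0 := by
    have h := ((IntervalIntegrable.iff_comp_neg (by simp)).1 hv₂).neg.symm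
    rw [neg_zero] at h
    exact h.congr fun s hs =>
      (hvneg s (by rw [uIoc_of_le (by linarith)] at hs; exact hs.2)).symm
  have hint := hint₂.trans hint₁
  have h0mem : (0 : ℝ) ∈ uIcc (-Real.pi) Real.pi := by
    rw [uIcc_of_le (by linarith)]; exact ⟨by linarith, hpi.le⟩
  have hI₁ : ∀ x, 0 ≤ x → ∫ s in (0 : ℝ)..x, v s = ∫ s in (0 : ℝ)..x, v₁ s := fun x hx =>
    intervalIntegral.integral_congr_ae (Eventually.of_forall fun s hs =>
      hvpos s (by rw [uIoc_of_le hx] at hs; exact hs.1))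
  have hI₂ : ∀ x, 0 ≤ x → ∫ s in (0 : ℝ)..(-x), v s = ∫ s in (0 : ℝ)..x, v₂ s := fun x hx => by
    have h1 : ∫ s in (0 : ℝ)..(-x), v s = ∫ s in (0 : ℝ)..(-x), -v₂ (-s) :=
      intervalIntegral.integral_congr_ae (Eventually.of_forall fun s hs =>
        hvneg s (by rw [uIoc_of_ge (by linarith)] at hs; exact hs.2))
    rw [h1, intervalIntegral.integral_neg, intervalIntegral.integral_comp_neg v₂, neg_neg, neg_zero,
      intervalIntegral.integral_symm, neg_neg]
  refine ⟨fun x => q 0 + ∫ s in (0 : ℝ)..x, v s, ?_, ?_, ?_, ?_⟩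
  · exact (absolutelyContinuousOnInterval_const _ _ _).add
      (hint.absolutelyContinuousOnInterval_integral h0mem)
  · rw [Filter.EventuallyEq, ae_restrict_iff' measurableSet_Ioo]
    have hne : ∀ᵐ x : ℝ, x ≠ 0 := by simp [ae_iff]
    filter_upwards [hint.ae_hasDerivAt_integral, hne] with x hx hx0 hxI
    have hd := (hx (by rw [uIcc_of_le (by linarith)]; exact Ioo_subset_Icc_self hxI) 0
      h0mem).const_add (q 0)
    rw [firstOrder, hd.deriv, ← hmq x, ← Complex.real_smul, ← Complex.real_smul]
    rcases lt_or_gt_of_ne hx0 with hlt | hgt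
    · have h := he₂ (-x) ⟨by linarith, by linarith [hxI.1]⟩
      rw [← hI₂ (-x) (by linarith), neg_neg, Real.cos_neg, Real.sin_neg] at h
      rw [hvneg x hlt.le, ← h]
      simp
    · rw [hI₁ x hgt.le, hvpos x hgt, he₁ x ⟨hgt, hxI.2⟩]
  · beta_reduce
    rw [hI₂ _ hpi.le, hπ₂]
    simpa using hmq (-Real.pi)
  · beta_reduce
    rw [hI₁ _ hpi.le, hπ₁]
    simpa using hmq Real.pi

/-! ### Explicit formula for the solution: uniqueness and bounds -/

/-- The solution operator of the first order equation. -/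
def solutionOperator (a b : ℝ) (u : ℝ → ℂ) (x : ℝ) : ℂ :=
  (integratingFactor a b x)⁻¹ • ∫ t in (0 : ℝ)..x, solutionKernel a b t • u t

theorem solutionOperator_neg (u : ℝ → ℂ) (x : ℝ) :
    solutionOperator a b u (-x) = solutionOperator a b (fun t => u (-t)) x := by
  rw [solutionOperator, solutionOperator, integratingFactor_neg]
  congr 1
  have h := intervalIntegral.integral_comp_neg (a := 0) (b := x)
    (fun t => solutionKernel a b t • u t)
  simp only [solutionKernel_neg, neg_smul, intervalIntegral.integral_neg, neg_zero] at h
  rw [intervalIntegral.integral_symm, ← h, neg_neg]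

theorem solutionOperator_zero (u : ℝ → ℂ) : solutionOperator a b u 0 = 0 := by
  simp [solutionOperator]

/-- The product p y is absolutely continuous on [0, x] with derivative w u and vanishes at 0.
Continuity of y at 0 is what excludes the homogeneous solutions c/p. -/
theorem solutionOperator_of_half (ha : 0 < a) (hb : 0 < b) (ha1 : a < 1) {y u : ℝ → ℂ}
    (hy : AbsolutelyContinuousOnInterval y 0 Real.pi)
    (h : ∀ᵐ x, x ∈ Ioo 0 Real.pi → u x = firstOrder a b y x) {x : ℝ} (hx : x ∈ Ioo 0 Real.pi) :
    y x = solutionOperator a b u x := by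
  have hxI : x ∈ Ico 0 Real.pi := ⟨hx.1.le, hx.2⟩
  have hyx : AbsolutelyContinuousOnInterval y 0 x := hy.mono (uIcc_subset_uIcc left_mem_uIcc
    (by rw [uIcc_of_le Real.pi_pos.le]; exact ⟨hx.1.le, hx.2.le⟩))
  have hpac := absolutelyContinuousOnInterval_integratingFactor ha hb ha1 hxI
  have hftc := (hpac.smul hyx).integral_deriv_eq_sub_complex
  have hcongr : ∫ t in (0 : ℝ)..x, deriv (integratingFactor a b • y) t =
      ∫ t in (0 : ℝ)..x, solutionKernel a b t • u t := by
    refine intervalIntegral.integral_congr_ae ?_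
    filter_upwards [h, hyx.ae_differentiableAt_complex] with t ht hd htI
    have hd' := (hd (uIoc_subset_uIcc htI)).hasDerivAt
    rw [uIoc_of_le hx.1.le] at htI
    have htI' : t ∈ Ioo 0 Real.pi := ⟨htI.1, htI.2.trans_lt hx.2⟩
    rw [((hasDerivAt_integratingFactor hb htI').smul hd').deriv, ht htI', firstOrder,
      ← mul_sin_mul_solutionKernel hb htI']
    simp only [Complex.real_smul]
    push_cast
    ring
  simp only [Pi.smul_apply', integratingFactor_zero hb ha1, zero_smul, sub_zero] at hftc
  rw [solutionOperator, ← hcongr, hftc, inv_smul_smul₀ (integratingFactor_pos hx).ne']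

theorem eq_solutionOperator (ha : 0 < a) (hb : 0 < b) (ha1 : a < 1) {y u : ℝ → ℂ}
    (hy : AbsolutelyContinuousOnInterval y (-Real.pi) Real.pi)
    (h : u =ᵐ[intervalMeasure] firstOrder a b y) {x : ℝ} (hx : x ∈ Ioo (-Real.pi) Real.pi)
    (hx0 : x ≠ 0) : y x = solutionOperator a b u x := by
  have hpi := Real.pi_pos
  rw [Filter.EventuallyEq, ae_restrict_iff' measurableSet_Ioo] at h
  rcases lt_or_gt_of_ne hx0 with hlt | hgt
  · have hy' : AbsolutelyContinuousOnInterval (fun x => y (-x)) 0 Real.pi := by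
      have h := hy.comp_neg
      rw [neg_neg] at h
      exact h.mono (uIcc_subset_uIcc
        (by rw [uIcc_of_ge (by linarith)]; exact ⟨by linarith, hpi.le⟩) left_mem_uIcc)
    have h' := (Measure.measurePreserving_neg (volume : Measure ℝ)).quasiMeasurePreserving.ae h
    have h2 := solutionOperator_of_half (u := fun t => u (-t)) ha hb ha1 hy' (by
      filter_upwards [h'] with t ht htI
      rw [ht ⟨by linarith [htI.2], by linarith [htI.1]⟩, firstOrder, firstOrder,
        deriv_comp_neg y t]
      simp) (x := -x) ⟨by linarith, by linarith [hx.1]⟩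
    rw [← solutionOperator_neg, neg_neg] at h2
    exact h2
  · refine solutionOperator_of_half ha hb ha1 (hy.mono (uIcc_subset_uIcc
      (by rw [uIcc_of_le (by linarith)]; exact ⟨by linarith, hpi.le⟩) right_mem_uIcc)) ?_
      ⟨hgt, hx.2⟩
    filter_upwards [h] with t ht htI
    exact ht ⟨by linarith [htI.1], htI.2⟩

theorem intervalIntegrable_solutionKernel_smul (ha : 0 < a) (hb : 0 < b) (ha1 : a < 1)
    {u : ℝ → ℂ} (hu : ContinuousOn u (Icc (-Real.pi) Real.pi)) {x : ℝ}
    (hx : x ∈ Ioo (-Real.pi) Real.pi) :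
    IntervalIntegrable (fun t => solutionKernel a b t • u t) volume 0 x := by
  have hw : IntervalIntegrable (solutionKernel a b) volume 0 x := by
    rcases le_total 0 x with h | h
    · exact intervalIntegrable_solutionKernel ha hb ha1 ⟨h, hx.2⟩
    · have h1 := (IntervalIntegrable.iff_comp_neg (by simp)).1
        (intervalIntegrable_solutionKernel ha hb ha1 (x := -x) ⟨by linarith, by linarith [hx.1]⟩)
      simp only [solutionKernel_neg, neg_zero, neg_neg] at h1
      simpa only [Pi.neg_def, neg_neg] using h1.neg
  refine hw.smul_continuousOn (hu.mono ?_)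
  rintro t ht
  rw [mem_uIcc] at ht
  rcases ht with h | h
  · exact ⟨by linarith [hx.1, Real.pi_pos], by linarith [hx.2]⟩
  · exact ⟨by linarith [hx.1], by linarith [Real.pi_pos]⟩

theorem solutionOperator_add (ha : 0 < a) (hb : 0 < b) (ha1 : a < 1) {u v : ℝ → ℂ}
    (hu : ContinuousOn u (Icc (-Real.pi) Real.pi)) (hv : ContinuousOn v (Icc (-Real.pi) Real.pi))
    {x : ℝ} (hx : x ∈ Ioo (-Real.pi) Real.pi) :
    solutionOperator a b (fun t => u t + v t) x =
      solutionOperator a b u x + solutionOperator a b v x := by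
  simp only [solutionOperator, smul_add]
  rw [intervalIntegral.integral_add (intervalIntegrable_solutionKernel_smul ha hb ha1 hu hx)
    (intervalIntegrable_solutionKernel_smul ha hb ha1 hv hx), smul_add]

theorem solutionOperator_smul (c : ℂ) (u : ℝ → ℂ) (x : ℝ) :
    solutionOperator a b (fun t => c * u t) x = c * solutionOperator a b u x := by
  simp only [solutionOperator, ← mul_smul_comm]
  rw [intervalIntegral.integral_const_mul, mul_smul_comm]

/-- From m w = p' and m ≥ 1 - a the kernel has mass at most p(x)/(1 - a), and the prefactor 1/p(x)
cancels the growth. -/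
theorem norm_solutionOperator_le_of_pos (ha : 0 < a) (hb : 0 < b) (ha1 : a < 1) {u : ℝ → ℂ} {M : ℝ}
    (hM : ∀ x ∈ Ioo 0 Real.pi, ‖u x‖ ≤ M) {x : ℝ} (hx : x ∈ Ioo 0 Real.pi) :
    ‖solutionOperator a b u x‖ ≤ M / (1 - a) := by
  have hp := integratingFactor_pos (a := a) (b := b) hx
  have hM0 : 0 ≤ M := (norm_nonneg _).trans (hM x hx)
  have h1a : 0 < 1 - a := sub_pos.2 ha1
  have hint := intervalIntegrable_deriv_integratingFactor ha hb ha1 (x := x) ⟨hx.1.le, hx.2⟩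
  have h := intervalIntegral.norm_integral_le_of_norm_le (μ := volume) hx.1.le
    (f := fun t => solutionKernel a b t • u t)
    (g := fun t => M / (1 - a) * ((1 - a * Real.cos t) * solutionKernel a b t))
    (Eventually.of_forall fun t ht => by
      have htI : t ∈ Ioo 0 Real.pi := ⟨ht.1, ht.2.trans_lt hx.2⟩
      have hw := solutionKernel_pos (a := a) hb htI
      rw [norm_smul, Real.norm_of_nonneg hw.le]
      calc solutionKernel a b t * ‖u t‖ ≤ solutionKernel a b t * M := by gcongr; exact hM t htI
        _ = M / (1 - a) * ((1 - a) * solutionKernel a b t) := by field_simp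
        _ ≤ _ := mul_le_mul_of_nonneg_left (mul_le_mul_of_nonneg_right
          (one_sub_le_one_sub_mul_cos ha t) hw.le) (div_nonneg hM0 h1a.le))
    (hint.const_mul _)
  rw [intervalIntegral.integral_const_mul, integral_deriv_integratingFactor ha hb ha1
    ⟨hx.1.le, hx.2⟩] at h
  rw [solutionOperator, norm_smul, norm_inv, Real.norm_of_nonneg hp.le, inv_mul_le_iff₀ hp]
  linarith

theorem norm_solutionOperator_le (ha : 0 < a) (hb : 0 < b) (ha1 : a < 1) {u : ℝ → ℂ} {M : ℝ}
    (hM : ∀ x ∈ Ioo (-Real.pi) Real.pi, ‖u x‖ ≤ M) {x : ℝ} (hx : x ∈ Ioo (-Real.pi) Real.pi) :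
    ‖solutionOperator a b u x‖ ≤ M / (1 - a) := by
  rcases lt_trichotomy x 0 with h | rfl | h
  · rw [← neg_neg x, solutionOperator_neg]
    exact norm_solutionOperator_le_of_pos ha hb ha1
      (fun t ht => hM _ ⟨by linarith [ht.2], by linarith [ht.1, hx.1]⟩)
      ⟨by linarith, by linarith [hx.1]⟩
  · rw [solutionOperator_zero, norm_zero]
    exact div_nonneg ((norm_nonneg _).trans (hM 0 hx)) (sub_pos.2 ha1).le
  · exact norm_solutionOperator_le_of_pos ha hb ha1
      (fun t ht => hM _ ⟨by linarith [ht.1, hx.2], ht.2⟩) ⟨h, hx.2⟩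

/-- Here m ≤ 1 + a gives w ≥ p'/(1 + a). The origin is excluded because there the formula takes the
default value 0. -/
theorem re_solutionOperator_one_ge (ha : 0 < a) (hb : 0 < b) (ha1 : a < 1) {x : ℝ}
    (hx : x ∈ Ioo (-Real.pi) Real.pi) (hx0 : x ≠ 0) :
    (1 + a)⁻¹ ≤ (solutionOperator a b (fun _ => 1) x).re := by
  have key : ∀ x ∈ Ioo 0 Real.pi, (1 + a)⁻¹ ≤ (solutionOperator a b (fun _ => 1) x).re := by
    intro x hx
    have hxI : x ∈ Ico 0 Real.pi := ⟨hx.1.le, hx.2⟩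
    have hp := integratingFactor_pos (a := a) (b := b) hx
    have h1 : ∫ t in (0 : ℝ)..x, solutionKernel a b t • (1 : ℂ) =
        ((∫ t in (0 : ℝ)..x, solutionKernel a b t : ℝ) : ℂ) := by
      rw [intervalIntegral.integral_smul_const, Complex.real_smul, mul_one]
    have h2 : integratingFactor a b x ≤ (1 + a) * ∫ t in (0 : ℝ)..x, solutionKernel a b t := by
      rw [← integral_deriv_integratingFactor ha hb ha1 hxI,
        ← intervalIntegral.integral_const_mul]
      refine intervalIntegral.integral_mono_on_of_le_Ioo hx.1.le
        (intervalIntegrable_deriv_integratingFactor ha hb ha1 hxI)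
        ((intervalIntegrable_solutionKernel ha hb ha1 hxI).const_mul _) fun t ht => ?_
      exact mul_le_mul_of_nonneg_right (one_sub_mul_cos_le ha t)
        (solutionKernel_pos hb ⟨ht.1, ht.2.trans hx.2⟩).le
    rw [solutionOperator, h1, Complex.real_smul, ← Complex.ofReal_mul, Complex.ofReal_re,
      inv_mul_eq_div, inv_eq_one_div, div_le_div_iff₀ (by linarith) hp]
    linarith
  rcases lt_or_gt_of_ne hx0 with h | h
  · rw [← neg_neg x, solutionOperator_neg]
    exact key (-x) ⟨by linarith, by linarith [hx.1]⟩
  · exact key x ⟨h, hx.2⟩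

/-- At the end points the first order expression reduces to `(1 + a) y`. -/
theorem boundary_values_of_firstOrder_eq (ha : 0 < a) (hb : 0 < b) (ha1 : a < 1) {y u : ℝ → ℂ}
    (hy : AbsolutelyContinuousOnInterval y (-Real.pi) Real.pi)
    (hu : AbsolutelyContinuousOnInterval u (-Real.pi) Real.pi)
    (h : u =ᵐ[intervalMeasure] firstOrder a b y) :
    (1 + a) • y (-Real.pi) = u (-Real.pi) ∧ (1 + a) • y Real.pi = u Real.pi := by
  have hpi := Real.pi_pos
  -- The boundary values are known for the constructed solution; uniqueness off 0 and continuity up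
  -- to the end points transfer them to y.
  obtain ⟨y', hy', h', h1, h2⟩ := exists_absolutelyContinuous_firstOrder_eq ha hb ha1 hu
  have hae : y =ᵐ[intervalMeasure] y' := by
    rw [Filter.EventuallyEq, ae_restrict_iff' measurableSet_Ioo]
    have hne : ∀ᵐ x : ℝ, x ≠ 0 := by simp [ae_iff]
    filter_upwards [hne] with x hx hxI
    rw [eq_solutionOperator ha hb ha1 hy h hxI hx, eq_solutionOperator ha hb ha1 hy' h' hxI hx]
  have hEq : EqOn y y' (Icc (-Real.pi) Real.pi) := by
    rw [← closure_Ioo (by linarith : -Real.pi ≠ Real.pi)]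
    have hc : ∀ {f : ℝ → ℂ}, AbsolutelyContinuousOnInterval f (-Real.pi) Real.pi →
        ContinuousOn f (closure (Ioo (-Real.pi) Real.pi)) := fun hf => by
      rw [closure_Ioo (by linarith), ← uIcc_of_le (by linarith)]; exact hf.continuousOn
    refine EqOn.of_subset_closure ?_ (hc hy) (hc hy') subset_closure subset_rfl
    exact Measure.eqOn_open_of_ae_eq hae isOpen_Ioo ((hc hy).mono subset_closure)
      ((hc hy').mono subset_closure)
  rw [hEq ⟨le_rfl, by linarith⟩, hEq ⟨by linarith, le_rfl⟩]
  exact ⟨h1, h2⟩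

end FullInterval

end

/-! ### Operators on `L²` given by bounded point evaluations -/

section PointEvaluation

variable {α : Type*} [MeasurableSpace α] {μ : Measure α}

theorem L2.integral_sq_norm (f : Lp ℂ 2 μ) : ∫ x, ‖f x‖ ^ 2 ∂μ = ‖f‖ ^ 2 := by
  have h := inner_self_eq_norm_sq_to_K (𝕜 := ℂ) f
  rw [L2.inner_def] at h
  have h1 : ∀ x, inner ℂ (f x) (f x) = ((‖f x‖ ^ 2 : ℝ) : ℂ) := fun x => by
    rw [inner_self_eq_norm_sq_to_K]; push_cast; rfl
  simp only [h1, integral_complex_ofReal] at h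
  rw [← Complex.ofReal_inj]
  refine h.trans ?_
  push_cast
  rfl

variable [IsFiniteMeasure μ]

/-- A linear assignment of measurable functions to elements of `L²` whose point evaluations are
uniformly bounded defines a Hilbert–Schmidt operator. -/
theorem exists_continuousLinearMap_of_bounded_evaluation {k : Lp ℂ 2 μ → α → ℂ} {C : ℝ}
    {s : Set α} (hs : ∀ᵐ x ∂μ, x ∈ s)
    (hadd : ∀ f g, ∀ x ∈ s, k (f + g) x = k f x + k g x)
    (hsmul : ∀ (c : ℂ) f, ∀ x ∈ s, k (c • f) x = c * k f x)
    (hbound : ∀ f, ∀ x ∈ s, ‖k f x‖ ≤ C * ‖f‖)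
    (hmeas : ∀ f, AEStronglyMeasurable (k f) μ) :
    ∃ K : Lp ℂ 2 μ →L[ℂ] Lp ℂ 2 μ, (∀ f, K f =ᵐ[μ] k f) ∧
      ∀ (ι : Type) (e : HilbertBasis ι ℂ (Lp ℂ 2 μ)), Summable fun i => ‖K (e i)‖ ^ 2 := by
  have hae : ∀ f, ∀ᵐ x ∂μ, ‖k f x‖ ≤ C * ‖f‖ := fun f => hs.mono (hbound f)
  have hmem : ∀ f, MemLp (k f) 2 μ := fun f => MemLp.of_bound (hmeas f) (C * ‖f‖) (hae f)
  have hae' : ∀ f, ∀ᵐ x ∂μ, ‖k f x‖ ≤ |C| * ‖f‖ := fun f => (hae f).mono fun x hx =>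
    hx.trans (mul_le_mul_of_nonneg_right (le_abs_self C) (norm_nonneg f))
  let K₀ : Lp ℂ 2 μ →ₗ[ℂ] Lp ℂ 2 μ :=
    { toFun := fun f => (hmem f).toLp
      map_add' := fun f g => by
        rw [← MemLp.toLp_add (hmem f) (hmem g), MemLp.toLp_eq_toLp_iff]
        exact hs.mono (hadd f g)
      map_smul' := fun c f => by
        rw [RingHom.id_apply, ← MemLp.toLp_const_smul c (hmem f), MemLp.toLp_eq_toLp_iff]
        exact hs.mono (hsmul c f) }
  have hK₀ : ∀ f, K₀ f =ᵐ[μ] k f := fun f => (hmem f).coeFn_toLp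
  have hK₀b : ∀ f, ‖K₀ f‖ ≤ (measureUnivNNReal μ : ℝ) ^ (2 : ENNReal).toReal⁻¹ * |C| * ‖f‖ :=
    fun f => by
      rw [mul_assoc]
      refine Lp.norm_le_of_ae_bound (by positivity) ?_
      filter_upwards [hK₀ f, hae' f] with x h1 h2
      rwa [h1]
  refine ⟨K₀.mkContinuous _ hK₀b, hK₀, fun ι e => ?_⟩
  refine summable_of_sum_le (c := ∫ _, |C| ^ 2 ∂μ) (fun i => by positivity) fun t => ?_
  have hsq : ∀ f, Integrable (fun x => ‖K₀ f x‖ ^ 2) μ := fun f =>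
    (Lp.memLp (K₀ f)).integrable_norm_pow two_ne_zero
  calc ∑ i ∈ t, ‖K₀ (e i)‖ ^ 2 = ∫ x, ∑ i ∈ t, ‖K₀ (e i) x‖ ^ 2 ∂μ := by
        rw [integral_finsetSum _ fun i _ => hsq _]
        exact Finset.sum_congr rfl fun i _ => (L2.integral_sq_norm _).symm
    _ ≤ ∫ _, |C| ^ 2 ∂μ := by
        refine integral_mono_ae (integrable_finsetSum _ fun i _ => hsq _) (integrable_const _) ?_
        have hall : ∀ᵐ x ∂μ, ∀ i ∈ t, K₀ (e i) x = k (e i) x :=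
          (ae_ball_iff t.countable_toSet).2 fun i _ => hK₀ (e i)
        filter_upwards [hall, hs] with x hx hxs
        -- For fixed x, Bessel applied to evaluation at x bounds the sum of squares by |C|²,
        -- uniformly in x and in the finite set.
        let l : Lp ℂ 2 μ →L[ℂ] ℂ := LinearMap.mkContinuous
          { toFun := fun f => k f x
            map_add' := fun f g => hadd f g x hxs
            map_smul' := fun c f => hsmul c f x hxs } |C| fun f =>
              (hbound f x hxs).trans (mul_le_mul_of_nonneg_right (le_abs_self C) (norm_nonneg f))
        have hl : ‖l‖ ≤ |C| := LinearMap.mkContinuous_norm_le _ (abs_nonneg C) _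
        calc ∑ i ∈ t, ‖K₀ (e i) x‖ ^ 2 = ∑ i ∈ t, ‖l (e i)‖ ^ 2 :=
              Finset.sum_congr rfl fun i hi => by rw [hx i hi]; rfl
          _ ≤ ‖l‖ ^ 2 := e.orthonormal.sum_sq_norm_apply_le l t
          _ ≤ |C| ^ 2 := by gcongr

theorem L2.norm_setIntegral_le (f : Lp ℂ 2 μ) {s : Set α} (hs : MeasurableSet s) :
    ‖∫ x in s, f x ∂μ‖ ≤ μ.real univ ^ (1 / 2 : ℝ) * ‖f‖ := by
  rw [← L2.inner_indicatorConstLp_one (𝕜 := ℂ) hs (measure_ne_top μ s)]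
  refine (norm_inner_le_norm _ _).trans (mul_le_mul_of_nonneg_right ?_ (norm_nonneg f))
  refine norm_indicatorConstLp_le.trans ?_
  rw [norm_one, one_mul, ENNReal.toReal_ofNat]
  exact Real.rpow_le_rpow measureReal_nonneg (measureReal_mono (subset_univ s)) (by norm_num)

end PointEvaluation

/-! ### The resolvent equation -/

noncomputable section

section ResolventEquation

theorem intervalIntegrable_L2Interval (f : L2Interval) :
    IntervalIntegrable f volume (-Real.pi) Real.pi := by
  rw [intervalIntegrable_iff_integrableOn_Ioo_of_le (by linarith [Real.pi_pos])]
  exact (Lp.memLp f).integrable one_le_two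

theorem zero_mem_uIcc_neg_pi_pi : (0 : ℝ) ∈ uIcc (-Real.pi) Real.pi := by
  rw [uIcc_of_le (by linarith [Real.pi_pos])]
  exact ⟨by linarith [Real.pi_pos], Real.pi_pos.le⟩

/-- The primitive of an element of `L²(-π, π)` vanishing at zero. -/
def primitive (f : ℝ → ℂ) (x : ℝ) : ℂ := ∫ t in (0 : ℝ)..x, f t

theorem absolutelyContinuousOnInterval_primitive (f : L2Interval) :
    AbsolutelyContinuousOnInterval (primitive f) (-Real.pi) Real.pi :=
  (intervalIntegrable_L2Interval f).absolutelyContinuousOnInterval_integral zero_mem_uIcc_neg_pi_pi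

theorem continuousOn_primitive (f : L2Interval) :
    ContinuousOn (primitive f) (Icc (-Real.pi) Real.pi) := by
  rw [← uIcc_of_le (by linarith [Real.pi_pos])]
  exact (absolutelyContinuousOnInterval_primitive f).continuousOn

theorem AbsolutelyContinuousOnInterval.aestronglyMeasurable_intervalMeasure {y : ℝ → ℂ}
    (hy : AbsolutelyContinuousOnInterval y (-Real.pi) Real.pi) :
    AEStronglyMeasurable y intervalMeasure := by
  refine (hy.continuousOn.mono ?_).aestronglyMeasurable measurableSet_Ioo
  rw [uIcc_of_le (by linarith [Real.pi_pos])]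
  exact Ioo_subset_Icc_self

theorem primitive_congr {f g : ℝ → ℂ} (h : f =ᵐ[intervalMeasure] g) {x : ℝ}
    (hx : x ∈ Icc (-Real.pi) Real.pi) : primitive f x = primitive g x := by
  refine intervalIntegral.integral_congr_ae ?_
  have hne : ∀ᵐ t : ℝ, t ≠ Real.pi := by simp [ae_iff]
  filter_upwards [(ae_restrict_iff' measurableSet_Ioo).1 h, hne] with t ht htπ htI
  refine ht ?_
  have := Real.pi_pos
  rw [mem_uIoc] at htI
  rcases htI with h | h
  · exact ⟨by linarith, lt_of_le_of_ne (h.2.trans hx.2) htπ⟩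
  · exact ⟨hx.1.trans_lt h.1, by linarith⟩

theorem primitive_add (f g : L2Interval) {x : ℝ} (hx : x ∈ Ioo (-Real.pi) Real.pi) :
    primitive (f + g : L2Interval) x = primitive f x + primitive g x := by
  have hsub : uIcc 0 x ⊆ uIcc (-Real.pi) Real.pi := uIcc_subset_uIcc zero_mem_uIcc_neg_pi_pi
    (by rw [uIcc_of_le (by linarith [Real.pi_pos])]; exact Ioo_subset_Icc_self hx)
  rw [primitive_congr (Lp.coeFn_add f g) (Ioo_subset_Icc_self hx)]
  exact intervalIntegral.integral_add ((intervalIntegrable_L2Interval f).mono_set hsub)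
    ((intervalIntegrable_L2Interval g).mono_set hsub)

theorem primitive_smul (c : ℂ) (f : L2Interval) {x : ℝ} (hx : x ∈ Ioo (-Real.pi) Real.pi) :
    primitive (c • f : L2Interval) x = c * primitive f x := by
  rw [primitive_congr (Lp.coeFn_smul c f) (Ioo_subset_Icc_self hx)]
  exact intervalIntegral.integral_const_mul c f

theorem norm_primitive_le (f : L2Interval) {x : ℝ} (hx : x ∈ Ioo (-Real.pi) Real.pi) :
    ‖primitive f x‖ ≤ intervalMeasure.real univ ^ (1 / 2 : ℝ) * ‖f‖ := by
  have hsub : uIoc 0 x ⊆ Ioo (-Real.pi) Real.pi := fun t ht => by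
    have := Real.pi_pos
    rw [mem_uIoc] at ht
    rcases ht with h | h
    · exact ⟨by linarith, by linarith [hx.2]⟩
    · exact ⟨by linarith [hx.1], by linarith⟩
  rw [primitive, intervalIntegral.norm_intervalIntegral_eq,
    ← inter_eq_left.2 hsub, ← Measure.restrict_restrict measurableSet_uIoc]
  exact L2.norm_setIntegral_le f measurableSet_uIoc

variable {a b : ℝ}

theorem ae_intervalMeasure_ne_zero : ∀ᵐ x ∂intervalMeasure, x ≠ 0 :=
  ae_restrict_of_ae (by simp [ae_iff])

theorem ae_intervalMeasure_mem : ∀ᵐ x ∂intervalMeasure, x ∈ Ioo (-Real.pi) Real.pi :=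
  ae_restrict_mem measurableSet_Ioo

theorem ae_eq_solutionOperator (ha : 0 < a) (hb : 0 < b) (ha1 : a < 1) {y u : ℝ → ℂ}
    (hy : AbsolutelyContinuousOnInterval y (-Real.pi) Real.pi)
    (h : u =ᵐ[intervalMeasure] firstOrder a b y) :
    y =ᵐ[intervalMeasure] solutionOperator a b u := by
  filter_upwards [ae_intervalMeasure_ne_zero, ae_intervalMeasure_mem] with x h0 hx
  exact eq_solutionOperator ha hb ha1 hy h hx h0

theorem aestronglyMeasurable_solutionOperator (ha : 0 < a) (hb : 0 < b) (ha1 : a < 1) {u : ℝ → ℂ}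
    (hu : AbsolutelyContinuousOnInterval u (-Real.pi) Real.pi) :
    AEStronglyMeasurable (solutionOperator a b u) intervalMeasure := by
  obtain ⟨y, hy, h, -, -⟩ := exists_absolutelyContinuous_firstOrder_eq ha hb ha1 hu
  exact hy.aestronglyMeasurable_intervalMeasure.congr (ae_eq_solutionOperator ha hb ha1 hy h)

/-- The composition of the solution operator with integration is Hilbert–Schmidt. -/
theorem exists_solutionOperator_primitive (ha : 0 < a) (hb : 0 < b) (ha1 : a < 1) :
    ∃ K : L2Interval →L[ℂ] L2Interval,
      (∀ f, K f =ᵐ[intervalMeasure] solutionOperator a b (primitive f)) ∧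
      ∀ (ι : Type) (e : HilbertBasis ι ℂ L2Interval), Summable fun i => ‖K (e i)‖ ^ 2 := by
  -- Primitives of sums and multiples of L² classes agree pointwise only on the interval, which is
  -- all that the solution operator sees.
  have hcongr : ∀ {u v : ℝ → ℂ}, EqOn u v (Ioo (-Real.pi) Real.pi) →
      ∀ x ∈ Ioo (-Real.pi) Real.pi, solutionOperator a b u x = solutionOperator a b v x := by
    intro u v huv x hx
    have := Real.pi_pos
    refine congrArg _ (intervalIntegral.integral_congr fun t ht => ?_)
    refine congrArg _ (huv ?_)
    rw [mem_uIcc] at ht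
    rcases ht with h | h
    · exact ⟨by linarith, by linarith [hx.2]⟩
    · exact ⟨by linarith [hx.1], by linarith⟩
  refine exists_continuousLinearMap_of_bounded_evaluation
    (C := intervalMeasure.real univ ^ (1 / 2 : ℝ) / (1 - a)) ae_intervalMeasure_mem
    (fun f g x hx => ?_) (fun c f x hx => ?_) (fun f x hx => ?_)
    (fun f => aestronglyMeasurable_solutionOperator ha hb ha1
      (absolutelyContinuousOnInterval_primitive f))
  · rw [hcongr (fun t ht => primitive_add f g ht) x hx]
    exact solutionOperator_add ha hb ha1 (continuousOn_primitive f) (continuousOn_primitive g) hx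
  · rw [hcongr (fun t ht => primitive_smul c f ht) x hx]
    exact solutionOperator_smul c _ x
  · rw [div_mul_eq_mul_div]
    exact norm_solutionOperator_le ha hb ha1 (fun t ht => norm_primitive_le f ht) hx

/-- Integration over `(-π, π)` as a bounded functional. -/
def totalIntegral : L2Interval →L[ℂ] ℂ :=
  innerSL ℂ (indicatorConstLp 2 MeasurableSet.univ (measure_ne_top intervalMeasure univ) (1 : ℂ))

theorem totalIntegral_apply (f : L2Interval) :
    totalIntegral f = ∫ x, f x ∂intervalMeasure := by
  rw [totalIntegral, innerSL_apply_apply, L2.inner_indicatorConstLp_one, Measure.restrict_univ]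

theorem totalIntegral_eq_sub (f : L2Interval) :
    totalIntegral f = primitive f Real.pi - primitive f (-Real.pi) := by
  have hpi := Real.pi_pos
  have h := intervalIntegrable_L2Interval f
  rw [primitive, primitive, intervalIntegral.integral_interval_sub_left
    (h.mono_set (uIcc_subset_uIcc zero_mem_uIcc_neg_pi_pi right_mem_uIcc))
    (h.mono_set (uIcc_subset_uIcc zero_mem_uIcc_neg_pi_pi left_mem_uIcc)),
    intervalIntegral.integral_of_le (by linarith), integral_Ioc_eq_integral_Ioo,
    totalIntegral_apply]

/-- The nonzero mean lets the coefficient of φ be adjusted so that the periodicity constraint ∫ g =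
0 can be met. -/
theorem exists_solutionOperator_one (ha : 0 < a) (hb : 0 < b) (ha1 : a < 1) :
    ∃ φ : L2Interval, φ =ᵐ[intervalMeasure] solutionOperator a b (fun _ => 1) ∧
      totalIntegral φ ≠ 0 := by
  have hmem : MemLp (solutionOperator a b fun _ => 1) 2 intervalMeasure := by
    refine MemLp.of_bound (aestronglyMeasurable_solutionOperator ha hb ha1
      (absolutelyContinuousOnInterval_const 1 _ _)) (1 / (1 - a)) ?_
    filter_upwards [ae_intervalMeasure_mem] with x hx
    exact norm_solutionOperator_le ha hb ha1 (fun t _ => norm_one.le) hx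
  obtain ⟨φ, hφ⟩ : ∃ φ : L2Interval, φ =ᵐ[intervalMeasure] solutionOperator a b (fun _ => 1) :=
    ⟨hmem.toLp, hmem.coeFn_toLp⟩
  refine ⟨φ, hφ, fun h => ?_⟩
  have hint : Integrable φ intervalMeasure := (Lp.memLp φ).integrable one_le_two
  have hre : ∫ x, (φ x).re ∂intervalMeasure = (∫ x, φ x ∂intervalMeasure).re := integral_re hint
  rw [← totalIntegral_apply, h, Complex.zero_re] at hre
  have hle : ∫ _, (1 + a)⁻¹ ∂intervalMeasure ≤ ∫ x, (φ x).re ∂intervalMeasure := by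
    refine integral_mono_ae (integrable_const _) hint.re ?_
    filter_upwards [hφ, ae_intervalMeasure_ne_zero, ae_intervalMeasure_mem] with x h1 h2 h3
    change (1 + a)⁻¹ ≤ (φ x).re
    rw [h1]
    exact re_solutionOperator_one_ge ha hb ha1 h3 h2
  rw [hre, integral_const, smul_eq_mul, measureReal_restrict_apply_univ,
    Real.volume_real_Ioo_of_le (by linarith [Real.pi_pos])] at hle
  have : 0 < (Real.pi - -Real.pi) * (1 + a)⁻¹ :=
    mul_pos (by linarith [Real.pi_pos]) (by positivity)
  linarith

/-! ### The graph of L and construction of one resolvent -/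

/-- The operator `L` in terms of the solution operator of the first order equation. -/
theorem mem_graphL_iff (ha : 0 < a) (hb : 0 < b) (ha1 : a < 1) {K : L2Interval →L[ℂ] L2Interval}
    (hK : ∀ f, K f =ᵐ[intervalMeasure] solutionOperator a b (primitive f)) {φ : L2Interval}
    (hφ : φ =ᵐ[intervalMeasure] solutionOperator a b fun _ => 1) (y g : L2Interval) :
    (y, g) ∈ graphL a b ↔ totalIntegral g = 0 ∧ ∃ c : ℂ, y = K g + c • φ := by
  have hpi := Real.pi_pos
  have h1a : (1 + a : ℝ) ≠ 0 := by positivity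
  have hsol : ∀ c : ℂ, (K g + c • φ : L2Interval) =ᵐ[intervalMeasure]
      solutionOperator a b fun t => primitive g t + c := fun c => by
    filter_upwards [Lp.coeFn_add (K g) (c • φ), Lp.coeFn_smul c φ, hK g, hφ,
      ae_intervalMeasure_mem] with x h1 h2 h3 h4 hx
    rw [h1, Pi.add_apply, h2, Pi.smul_apply, h3, h4, solutionOperator_add ha hb ha1
      (continuousOn_primitive g) continuousOn_const hx, smul_eq_mul, ← solutionOperator_smul]
    simp
  constructor
  · rintro ⟨Y, u, hY, h⟩
    -- As u' = g, u is the primitive of g plus u(0), which is the coefficient of φ.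
    have hg : ∀ x ∈ Icc (-Real.pi) Real.pi, primitive g x = u x - u 0 := fun x hx => by
      have hx' : x ∈ uIcc (-Real.pi) Real.pi := by rwa [uIcc_of_le (by linarith)]
      have h1 := (h.ac_first.mono
        (uIcc_subset_uIcc zero_mem_uIcc_neg_pi_pi hx')).integral_deriv_eq_sub_complex
      exact (primitive_congr h.deriv_eq hx).trans h1
    have hπ := boundary_values_of_firstOrder_eq ha hb ha1 h.ac h.ac_first h.first_eq
    refine ⟨?_, u 0, ?_⟩
    · rw [totalIntegral_eq_sub, hg _ ⟨by linarith, le_rfl⟩, hg _ ⟨le_rfl, by linarith⟩, ← hπ.1,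
        ← hπ.2, h.periodic]
      ring
    · refine Lp.ext ((hY.trans (ae_eq_solutionOperator ha hb ha1 h.ac ?_)).trans (hsol (u 0)).symm)
      refine EventuallyEq.trans ?_ h.first_eq
      filter_upwards [ae_intervalMeasure_mem] with x hx
      rw [hg x (Ioo_subset_Icc_self hx)]; ring
  · rintro ⟨hg, c, rfl⟩
    have hu : AbsolutelyContinuousOnInterval (fun t => primitive g t + c) (-Real.pi) Real.pi :=
      (absolutelyContinuousOnInterval_primitive g).add (absolutelyContinuousOnInterval_const c _ _)
    obtain ⟨Y, hY, h, h1, h2⟩ := exists_absolutelyContinuous_firstOrder_eq ha hb ha1 hu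
    refine ⟨Y, _, (hsol c).trans (ae_eq_solutionOperator ha hb ha1 hY h).symm, hY, ?_, hu, h, ?_⟩
    -- Zero mean equates the end values of u, and dividing by 1 + a equates those of Y.
    · rw [totalIntegral_eq_sub, sub_eq_zero] at hg
      rw [← hg, ← h2] at h1
      exact smul_right_injective ℂ h1a h1
    · have hd := (intervalIntegrable_L2Interval g).ae_hasDerivAt_integral
      rw [Filter.EventuallyEq, ae_restrict_iff' measurableSet_Ioo]
      filter_upwards [hd] with x hx hxI
      have hx' : x ∈ uIcc (-Real.pi) Real.pi := by
        rw [uIcc_of_le (by linarith)]; exact Ioo_subset_Icc_self hxI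
      exact ((hx hx' 0 zero_mem_uIcc_neg_pi_pi).add_const c).deriv.symm

theorem exists_isResolventAt_operatorL (ha : 0 < a) (hb : 0 < b) (ha1 : a < 1) :
    ∃ (z : ℂ) (R : L2Interval →L[ℂ] L2Interval), IsResolventAt (operatorL a b) z R ∧
      IsHilbertSchmidt R := by
  obtain ⟨K, hK, hKS⟩ := exists_solutionOperator_primitive ha hb ha1
  obtain ⟨φ, hφ, hφ0⟩ := exists_solutionOperator_one ha hb ha1
  have hgraph := mem_graphL_iff ha hb ha1 hK hφ
  have hmem : ∀ y g, (∃ h : y ∈ (operatorL a b).domain, operatorL a b ⟨y, h⟩ = g) ↔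
      (y, g) ∈ graphL a b := fun y g => by
    rw [← operatorL_graph, LinearPMap.mem_graph_iff]
    constructor
    · rintro ⟨h, h'⟩; exact ⟨⟨y, h⟩, rfl, h'⟩
    · rintro ⟨⟨_, h⟩, rfl, h'⟩; exact ⟨h, h'⟩
  -- Invertibility and ∫ Sφ ≠ 0 are open conditions holding at z = 0. The point 0 itself must be
  -- avoided, being an eigenvalue with eigenvector φ.
  obtain ⟨z, hz0, hunit, hzφ⟩ : ∃ z : ℂ, z ≠ 0 ∧ IsUnit (1 - z • K) ∧
      totalIntegral (Ring.inverse (1 - z • K) φ) ≠ 0 := by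
    have hlim : Tendsto (fun z : ℂ => 1 - z • K) (𝓝 0) (𝓝 1) := by
      have : Continuous fun z : ℂ => 1 - z • K := by fun_prop
      simpa using this.tendsto 0
    have h1 : ∀ᶠ z : ℂ in 𝓝 0, IsUnit (1 - z • K) := by
      have := Units.nhds (1 : (L2Interval →L[ℂ] L2Interval)ˣ)
      exact hlim.eventually this
    have h2 : Tendsto (fun z : ℂ => totalIntegral (Ring.inverse (1 - z • K) φ)) (𝓝 0)
        (𝓝 (totalIntegral φ)) := by
      have h3 := (NormedRing.inverse_continuousAt (1 : (L2Interval →L[ℂ] L2Interval)ˣ)).tendsto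
      rw [Units.val_one, Ring.inverse_one] at h3
      have h4 : Continuous fun S : L2Interval →L[ℂ] L2Interval => totalIntegral (S φ) := by
        fun_prop
      exact (h4.tendsto 1).comp (h3.comp hlim)
    have h5 := (h1.and (h2.eventually_ne hφ0)).filter_mono
      (nhdsWithin_le_nhds : 𝓝[≠] (0 : ℂ) ≤ 𝓝 0)
    obtain ⟨z, hz, hz'⟩ := (h5.and self_mem_nhdsWithin).exists
    exact ⟨z, hz', hz.1, hz.2⟩
  set S := Ring.inverse (1 - z • K) with hS
  have hSl : ∀ f, S (f - z • K f) = f := fun f =>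
    congrArg (fun T => T f) (Ring.inverse_mul_cancel _ hunit)
  have hSr : ∀ f, S f - z • K (S f) = f := fun f =>
    congrArg (fun T => T f) (Ring.mul_inverse_cancel _ hunit)
  -- The coefficient c obtained by solving ∫ (f + z(SKf + c Sφ)) = 0.
  let l : L2Interval →L[ℂ] ℂ :=
    (-(z * totalIntegral (S φ))⁻¹) • (totalIntegral + z • (totalIntegral ∘L (S * K)))
  have hl : ∀ f, totalIntegral f + z * (totalIntegral (S (K f)) + l f * totalIntegral (S φ)) = 0 :=
    fun f => by
      have : l f = (-(z * totalIntegral (S φ))⁻¹) *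
        (totalIntegral f + z * totalIntegral (S (K f))) := rfl
      rw [this]
      field_simp
      ring
  let R : L2Interval →L[ℂ] L2Interval := S * K + l.smulRight (S φ)
  have hR : ∀ f, R f = S (K f) + l f • S φ := fun f => rfl
  have hright : ∀ f, ∃ h : R f ∈ (operatorL a b).domain,
      operatorL a b ⟨R f, h⟩ = f + z • R f := fun f => by
    rw [hmem, hgraph]
    refine ⟨?_, l f, ?_⟩
    · rw [hR, map_add, map_smul, map_add, map_smul, smul_eq_mul, smul_eq_mul]
      exact hl f
    · have h1 := hSr (K f + l f • φ)
      rw [map_add, map_smul, ← hR] at h1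
      rw [map_add, map_smul]
      refine (sub_eq_iff_eq_add.1 h1).trans ?_
      abel
  -- Injectivity of L - z turns the right inverse into a two-sided one: a kernel element is c Sφ,
  -- and zero mean of its image forces c = 0.
  have hinj : ∀ y : (operatorL a b).domain, operatorL a b y = z • (y : L2Interval) →
      (y : L2Interval) = 0 := fun y hy => by
    have h1 := (hmem y (z • (y : L2Interval))).1 ⟨y.2, hy⟩
    rw [hgraph] at h1
    obtain ⟨h2, c, h3⟩ := h1
    have h4 : (y : L2Interval) = c • S φ := by
      rw [map_smul] at h3
      exact (hSl y).symm.trans ((congrArg S (sub_eq_iff_eq_add'.2 h3)).trans (map_smul S c φ))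
    rw [h4, map_smul, map_smul, smul_eq_mul, smul_eq_mul] at h2
    have hc : c = 0 := by
      rcases mul_eq_zero.1 h2 with h | h
      · exact absurd h hz0
      · exact (mul_eq_zero.1 h).resolve_right hzφ
    rw [h4, hc, zero_smul]
  refine ⟨z, R, ⟨fun f => (hright f).1, fun f => ?_, fun y => ?_⟩, ?_⟩
  · rw [(hright f).2, add_sub_cancel_right]
  · obtain ⟨h1, h2⟩ := hright (operatorL a b y - z • (y : L2Interval))
    have h3 := hinj (⟨_, h1⟩ - y) (by
      rw [LinearPMap.map_sub, h2, AddSubgroupClass.coe_sub, smul_sub]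
      abel)
    rw [AddSubgroupClass.coe_sub] at h3
    exact sub_eq_zero.1 h3
  · obtain ⟨w, e, -⟩ := exists_hilbertBasis ℂ L2Interval
    exact ⟨w, e, e.summable_sq_norm_add (e.summable_sq_norm_comp_left (hKS w e) S)
      (e.summable_sq_norm_smulRight l (S φ))⟩

end ResolventEquation

end

theorem theorem2 (a b : ℝ) (ha : 0 < a) (hb : 0 < b) (hab : 2 * a + b < 2) :
    (unboundedResolventSet (operatorL a b)).Nonempty ∧
    (∀ (z : ℂ) (R : L2Interval →L[ℂ] L2Interval), IsResolventAt (operatorL a b) z R →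
      IsCompactOperator R ∧ IsHilbertSchmidt R) ∧
    (∀ r : ℝ, (unboundedSpectrum (operatorL a b) ∩ Metric.closedBall 0 r).Finite) ∧
    (∀ z ∈ unboundedSpectrum (operatorL a b),
      IsUnboundedEigenvalue (operatorL a b) z ∧
      FiniteDimensional ℂ (rootSpace (operatorL a b) z)) := by
  obtain ⟨z, R, h, hHS⟩ := exists_isResolventAt_operatorL ha hb (by linarith : a < 1)
  exact unbounded_discrete_spectrum_of_isResolventAt h hHS
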